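/- Let $P,\sigma,\sigma_w>0$. Among $\ell$ users, $k=k(\ell)$ are active, where $k=\Theta(1)$ as $\ell\to\infty$ (for instance, $k\ge 1$ constant). User $i$ has a preamble of length $n$ with entries $X^i_t\in\{0,\sqrt P\}$, $1\le t\le n$, where $X_t^i=\sqrt P\,B_t^i$ with $B_t^i$ i.i.d. $\mathrm{Bern}(q)$ over $i$ and $t$. If $A\subseteq\{1,\dots,\ell\}$, $|A|=k$, is the set of active users, the received symbol in channel use $t$ is $S_t=\sum_{i\in A}h_t^iX_t^i+w_t$, where the fading coefficients $h_t^i\sim\mathcal{CN}(0,\sigma^2)$ are i.i.d. over $i$ and $t$, the noise variables $w_t\sim\mathcal{CN}(0,\sigma_w^2)$ are i.i.d. over $t$, and preambles, fading and noise are independent. The receiver knows $k$, all the preambles, and only the energy detector outputs $Z_t=\mathbf 1\{|S_t|^2>\gamma\}$, $1\le t\le n$, for a threshold $\gamma>0$. An identification scheme of length $n$ consists of $q\in[0,1]$, $\gamma>0$ and, for every set of preambles, an activity detection function that maps $(Z_1,\dots,Z_n)$ to a set $\hat A\subseteq\{1,\dots,\ell\}$ with $|\hat A|=k$. Its probability of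 erroneous identification is $$\mathbb P_e^{(\ell)}=\frac1{\binom{\ell}{k}}\sum_{A:\,|A|=k}\mathbb P\bigl(\hat A\ne A\mid A\text{ is the active set}\bigr),$$ where the probability is over preambles, fading and noise. A function $n(\ell)$ is called a minimum user identification cost if for every $0<\epsilon<1$ - there are schemes of length $\lceil(1+\epsilon)n(\ell)\rceil$ with $\mathbb P_e^{(\ell)}\to0$ as $\ell\to\infty$, and - there is $\delta>0$ such that, for all sufficiently large $\ell$, every scheme of length $\lfloor(1-\epsilon)n(\ell)\rfloor$ has $\mathbb P_e^{(\ell)}\ge\delta$. With logarithms to base 2 and $h(x)=-x\log x-(1-x)\log(1-x)$, let, for every integer $k\ge1$, $$C_k=\max_{\gamma>0,\ q\in[0,1]}\left\{h\Bigl(\mathbb E\Bigl[e^{-\frac{\gamma}{V\sigma^2P+\sigma_w^2}}\Bigr]\Bigr)-\mathbb E\Bigl[h\Bigl(e^{-\frac{\gamma}{V\sigma^2P+\sigma_w^2}}\Bigr)\Bigr]\right\},\qquad V\sim\mathrm{Bin}(k,q).$$ Theorem. For every $k\ge1$ the maximum $C_k$ is attained and positive, and $$n(\ell)=\frac{k\log\ell}{C_k},\qquad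 k=k(\ell),$$ is a minimum user identification cost of the non-coherent $(\ell,k)$-many-access channel with $k=\Theta(1)$. -/

import Mathlib

open MeasureTheory ProbabilityTheory Filter Topology Asymptotics
open scoped NNReal

namespace MnAC

noncomputable section

/-- The circularly symmetric complex Gaussian law `CN(0, v)`: independent real and imaginary
parts, each `N(0, v / 2)`. -/
def complexGaussian (v : ℝ≥0) : Measure ℂ :=
  ((gaussianReal 0 (v / 2)).prod (gaussianReal 0 (v / 2))).map
    Complex.measurableEquivRealProd.symm

/-- A set of binary preambles of length `n` for `ℓ` users: `X i t = true` means that user `i`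
sends an `On` symbol in channel use `t`. -/
abbrev Preambles (ℓ n : ℕ) : Type := Fin ℓ → Fin n → Bool

/-- The law of i.i.d. `Bern(q)` preambles. -/
def preambleLaw (ℓ n : ℕ) (q : unitInterval) : Measure (Preambles ℓ n) :=
  Measure.pi fun _ => Measure.pi fun _ => bernoulliMeasure true false q

/-- The law of the fading coefficients: `h t i` is the coefficient of user `i` in channel use
`t`, i.i.d. `CN(0, σ²)` over users and channel uses (fast Rayleigh fading). -/
def fadingLaw (σ : ℝ≥0) (ℓ n : ℕ) : Measure (Fin n → Fin ℓ → ℂ) :=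
  Measure.pi fun _ => Measure.pi fun _ => complexGaussian (σ ^ 2)

/-- The law of the receiver noise: i.i.d. `CN(0, σ_w²)` over channel uses. -/
def noiseLaw (σw : ℝ≥0) (n : ℕ) : Measure (Fin n → ℂ) :=
  Measure.pi fun _ => complexGaussian (σw ^ 2)

/-- The joint law of preambles, fading and noise, which are mutually independent. -/
def channelLaw (σ σw : ℝ≥0) (ℓ n : ℕ) (q : unitInterval) :
    Measure (Preambles ℓ n × (Fin n → Fin ℓ → ℂ) × (Fin n → ℂ)) :=
  (preambleLaw ℓ n q).prod ((fadingLaw σ ℓ n).prod (noiseLaw σw n))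

/-- The OOK symbol, in `{0, √P}`, that a preamble bit stands for. -/
def ookSymbol (P : ℝ≥0) (b : Bool) : ℂ := if b then ((√(P : ℝ) : ℝ) : ℂ) else 0

/-- The activity status vector of the active set `A`. -/
def activity {ℓ : ℕ} (A : Finset (Fin ℓ)) (i : Fin ℓ) : ℂ := if i ∈ A then 1 else 0

/-- The received symbol `S_t = (β ∘ h_t) · X_t + w_t`. -/
def received (P : ℝ≥0) {ℓ n : ℕ} (A : Finset (Fin ℓ)) (X : Preambles ℓ n)
    (h : Fin n → Fin ℓ → ℂ) (w : Fin n → ℂ) (t : Fin n) : ℂ :=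
  ∑ i, (activity A i * h t i) * ookSymbol P (X i t) + w t

open Classical in
/-- The energy detector output: `Z_t = 1` if `|S_t|² > γ`, and `Z_t = 0` otherwise. -/
def output (P : ℝ≥0) (γ : ℝ) {ℓ n : ℕ} (A : Finset (Fin ℓ)) (X : Preambles ℓ n)
    (h : Fin n → Fin ℓ → ℂ) (w : Fin n → ℂ) (t : Fin n) : Bool :=
  decide (γ < ‖received P A X h w t‖ ^ 2)

/-- A choice of everything that is free in an identification scheme for `ℓ` users, `k` of them
active, with preambles of length `n`: the sampling probability of the preambles, the threshold
of the energy detector, and for every set of preambles an activity detection function, which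
estimates the active set by a set of size `k` (a requirement made only when there is such a set,
that is, when `k ≤ ℓ`). -/
structure Scheme (ℓ k n : ℕ) where
  q : unitInterval
  γ : ℝ
  γ_pos : 0 < γ
  detect : Preambles ℓ n → (Fin n → Bool) → Finset (Fin ℓ)
  card_detect : k ≤ ℓ → ∀ X z, (detect X z).card = k

/-- The probability of erroneous identification, averaged over the `ℓ.choose k` active sets. -/
def errorProb (P σ σw : ℝ≥0) {ℓ k n : ℕ} (s : Scheme ℓ k n) : ℝ :=
  1 / (ℓ.choose k : ℝ) *
    ∑ A ∈ Finset.powersetCard k (Finset.univ : Finset (Fin ℓ)),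
      (channelLaw σ σw ℓ n s.q).real
        {ω | s.detect ω.1 (output P s.γ A ω.1 ω.2.1 ω.2.2) ≠ A}

/-- `cost` is a minimum user identification cost when `k ℓ` of the `ℓ` users are active: for
every `0 < ε < 1`, some schemes with preambles of length `(1 + ε) cost ℓ` have vanishing error
probability, and the error probability of all schemes with preambles of length `(1 - ε) cost ℓ`
is bounded away from zero. -/
def IsMinIdentificationCost (P σ σw : ℝ≥0) (k : ℕ → ℕ) (cost : ℕ → ℝ) : Prop :=
  ∀ ε : ℝ, 0 < ε → ε < 1 →
    (∃ s : ∀ ℓ : ℕ, Scheme ℓ (k ℓ) ⌈(1 + ε) * cost ℓ⌉₊,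
      Tendsto (fun ℓ => errorProb P σ σw (s ℓ)) atTop (𝓝 0)) ∧
    (∃ δ : ℝ, 0 < δ ∧ ∀ᶠ ℓ in atTop,
      ∀ s : Scheme ℓ (k ℓ) ⌊(1 - ε) * cost ℓ⌋₊, δ ≤ errorProb P σ σw s)

/-- The binary entropy function, in bits. -/
def entropy (x : ℝ) : ℝ := -x * Real.logb 2 x - (1 - x) * Real.logb 2 (1 - x)

/-- `e^{-γ / (v σ² P + σ_w²)}`. -/
def hitProb (P σ σw : ℝ≥0) (γ : ℝ) (v : ℕ) : ℝ :=
  Real.exp (-(γ / (v * (σ : ℝ) ^ 2 * P + (σw : ℝ) ^ 2)))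

/-- `h(E[e^{-γ / (V σ² P + σ_w²)}]) - E[h(e^{-γ / (V σ² P + σ_w²)})]` for `V ~ Bin(k, q)`. -/
def rate (P σ σw : ℝ≥0) (k : ℕ) (γ : ℝ) (q : unitInterval) : ℝ :=
  entropy (∫ v, hitProb P σ σw γ v ∂(binomial k q)) -
    ∫ v, entropy (hitProb P σ σw γ v) ∂(binomial k q)

/-- The values of the rate over all thresholds and sampling probabilities. -/
def rates (P σ σw : ℝ≥0) (k : ℕ) : Set ℝ :=
  {r | ∃ γ : ℝ, 0 < γ ∧ ∃ q : unitInterval, r = rate P σ σw k γ q}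

/-- The maximum rate `C`, for `k` active users. -/
def maxRate (P σ σw : ℝ≥0) (k : ℕ) : ℝ := sSup (rates P σ σw k)

end

end MnAC

/-! Given the preambles, the symbol received in one channel use is circularly symmetric Gaussian,
with a variance that depends only on the number `v` of active users sending `On`. Its energy is
therefore exponential, and the detector fires with probability `hitProb v`. So the outputs come from
a memoryless channel with `k` i.i.d. input bits and one output bit, and `rate` is the mutual
information between all `k` bits and the output. Once this is shown (`channelLaw_real_eq_sum`),
error probabilities are finite sums and the coding argument uses no measure theory. It works in
nats, with `log 2` converting to bits.

Converse: there are `ℓ.choose k` messages, whose logarithm is `k log ℓ` up to a constant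
(`sub_le_log_choose`), and one channel use carries at most `C_k` bits. Fano's inequality
(`sum_correct_mul_log_le`) concludes.

Achievability: the error is averaged over random preambles, so a random coding bound suffices. A
threshold decoder tests information densities. At most `ℓ ^ i` wrong sets differ from the active one
in `i` users and share a given intersection with it, and excluding them needs `n I_i > i log ℓ`.
Here `I_i` is the information about `i` users when the other `k - i` are known. Conditioning on
further independent inputs increases information about a given input, so conditional entropy is
concave in the number of unknown users and `I_i / i ≥ I_k / k` (`condEntropy_sub_ge`). Hence only
the constraint `i = k` matters, and it gives the cost.

The maximum is attained because the rate is continuous and vanishes, uniformly in `q`, as the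
threshold tends to `0` or infinity. A sequence `k ℓ = Θ(1)` eventually takes finitely many positive
values, so results for constant `k` combine. -/

namespace MnAC

/-! ### Binomial averages -/

/-- The mean of `f V` for `V ~ Bin(m, q)`, by recursion on the number of trials. -/
noncomputable def binomialMean (q : ℝ) : ℕ → (ℕ → ℝ) → ℝ
  | 0, f => f 0
  | m + 1, f => (1 - q) * binomialMean q m f + q * binomialMean q m fun v => f (v + 1)

section BinomialMean

variable {q : ℝ}

lemma binomialMean_add (m : ℕ) (f g : ℕ → ℝ) :
    binomialMean q m (fun v => f v + g v) = binomialMean q m f + binomialMean q m g := by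
  induction m generalizing f g with
  | zero => rfl
  | succ m ih => simp only [binomialMean, ih]; ring

lemma binomialMean_const_mul (m : ℕ) (c : ℝ) (f : ℕ → ℝ) :
    binomialMean q m (fun v => c * f v) = c * binomialMean q m f := by
  induction m generalizing f with
  | zero => rfl
  | succ m ih => simp only [binomialMean, ih]; ring

lemma binomialMean_mul_const (m : ℕ) (c : ℝ) (f : ℕ → ℝ) :
    binomialMean q m (fun v => f v * c) = binomialMean q m f * c := by
  simp only [mul_comm _ c, binomialMean_const_mul]

lemma binomialMean_sub (m : ℕ) (f g : ℕ → ℝ) :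
    binomialMean q m (fun v => f v - g v) = binomialMean q m f - binomialMean q m g := by
  induction m generalizing f g with
  | zero => rfl
  | succ m ih => simp only [binomialMean, ih]; ring

lemma binomialMean_const (m : ℕ) (c : ℝ) : binomialMean q m (fun _ => c) = c := by
  induction m with
  | zero => rfl
  | succ m ih => simp only [binomialMean, ih]; ring

/-- Peels a trial off inside the average rather than outside, so that averages over different
numbers of trials can be compared under one common outer average. -/
lemma binomialMean_succ' (m : ℕ) (f : ℕ → ℝ) :
    binomialMean q (m + 1) f = binomialMean q m fun v => (1 - q) * f v + q * f (v + 1) := by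
  rw [binomialMean_add, binomialMean_const_mul, binomialMean_const_mul, binomialMean]

lemma binomialMean_add_trials (m m' : ℕ) (f : ℕ → ℝ) :
    binomialMean q (m + m') f =
      binomialMean q m fun u => binomialMean q m' fun v => f (u + v) := by
  induction m generalizing f with
  | zero => simp [binomialMean]
  | succ m ih =>
    rw [Nat.succ_add]
    simp only [binomialMean, ih]
    simp only [add_right_comm]

lemma binomialMean_mono (h0 : 0 ≤ q) (h1 : q ≤ 1) {m : ℕ} {f g : ℕ → ℝ}
    (h : ∀ v ≤ m, f v ≤ g v) : binomialMean q m f ≤ binomialMean q m g := by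
  induction m generalizing f g with
  | zero => exact h 0 le_rfl
  | succ m ih =>
    exact add_le_add
      (mul_le_mul_of_nonneg_left (ih fun v hv => h v (by omega)) (by linarith))
      (mul_le_mul_of_nonneg_left (ih fun v hv => h (v + 1) (by omega)) h0)

lemma binomialMean_congr {m : ℕ} {f g : ℕ → ℝ}
    (h : ∀ v ≤ m, f v = g v) : binomialMean q m f = binomialMean q m g := by
  induction m generalizing f g with
  | zero => exact h 0 le_rfl
  | succ m ih =>
    simp only [binomialMean]
    rw [ih fun v hv => h v (by omega), ih fun v hv => h (v + 1) (by omega)]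

lemma binomialMean_mem_Ioo (h0 : 0 ≤ q) (h1 : q ≤ 1) {m : ℕ} {f : ℕ → ℝ}
    (h : ∀ v, f v ∈ Set.Ioo (0 : ℝ) 1) : binomialMean q m f ∈ Set.Ioo (0 : ℝ) 1 := by
  induction m generalizing f with
  | zero => exact h 0
  | succ m ih =>
    exact (convex_Ioo (0 : ℝ) 1) (ih h) (ih fun v => h (v + 1)) (by linarith) h0 (by ring)

lemma hasDerivAt_binomialMean (m : ℕ) {f : ℝ → ℕ → ℝ} {f' : ℕ → ℝ} {x : ℝ}
    (h : ∀ v, HasDerivAt (fun y => f y v) (f' v) x) :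
    HasDerivAt (fun y => binomialMean q m (f y)) (binomialMean q m f') x := by
  induction m generalizing f f' with
  | zero => exact h 0
  | succ m ih =>
    exact ((ih h).const_mul _).add ((ih fun v => h (v + 1)).const_mul _)

lemma binomialMean_eq_sum (m : ℕ) (f : ℕ → ℝ) :
    binomialMean q m f =
      ∑ j ∈ Finset.range (m + 1), m.choose j * (q ^ j * (1 - q) ^ (m - j) * f j) := by
  induction m generalizing f with
  | zero => simp [binomialMean]
  | succ m ih =>
    rw [binomialMean, ih, ih,
      Finset.sum_choose_succ_mul (fun i j => q ^ i * (1 - q) ^ j * f i) m,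
      Finset.mul_sum, Finset.mul_sum]
    congr 1
    · refine Finset.sum_congr rfl fun j hj => ?_
      rw [show m + 1 - j = m - j + 1 by have := Finset.mem_range.1 hj; omega]
      ring
    · refine Finset.sum_congr rfl fun j _ => ?_
      ring

lemma integral_binomial_eq_binomialMean (m : ℕ) (q : unitInterval) (f : ℕ → ℝ) :
    ∫ v, f v ∂(binomial m q) = binomialMean (q : ℝ) m f := by
  rw [integral_binomial, binomialMean_eq_sum, Nat.range_succ_eq_Iic]
  refine Finset.sum_congr rfl fun j _ => ?_
  rw [smul_eq_mul]; ring

end BinomialMean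

/-! ### Concavity of conditional entropy in the number of unknown users -/

/-- The information inequality behind the monotonicity of the conditional mutual information
`I(X; Z ∣ Y)` under conditioning on further independent symbols, for two binary symbols. -/
lemma negMulLog_mix_le {q a b c : ℝ} (h0 : 0 ≤ q) (h1 : q ≤ 1)
    (ha : 0 < a) (hb : 0 < b) (hc : 0 < c) :
    ((1 - q) * Real.negMulLog ((1 - q) * ((1 - q) * a + q * b) + q * ((1 - q) * b + q * c)) +
      q * Real.negMulLog ((1 - q) * ((1 - q) * a + q * b) + q * ((1 - q) * b + q * c))) +
      ((1 - q) * ((1 - q) * Real.negMulLog a + q * Real.negMulLog b) +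
        q * ((1 - q) * Real.negMulLog b + q * Real.negMulLog c)) ≤
    2 * ((1 - q) * Real.negMulLog ((1 - q) * a + q * b) +
      q * Real.negMulLog ((1 - q) * b + q * c)) := by
  set d := (1 - q) * a + q * b with hd
  set e := (1 - q) * b + q * c with he
  set m := (1 - q) * d + q * e with hm
  have hmix : ∀ {x y : ℝ}, 0 < x → 0 < y → 0 < (1 - q) * x + q * y := fun hx hy =>
    (convex_Ioi (0 : ℝ)) hx hy (by linarith) h0 (by ring)
  have hd' : 0 < d := hmix ha hb
  have he' : 0 < e := hmix hb hc
  have hm' : 0 < m := hmix hd' he'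
  -- This is `log t ≤ t - 1` at `t = y z / (m x)`. It compares the true probability `x` of the
  -- output given both symbols with `y z / m`, as in the proof that conditional mutual information
  -- is nonnegative.
  have key : ∀ {x y z : ℝ}, 0 < x → 0 < y → 0 < z →
      x * (Real.log y + Real.log z - Real.log m - Real.log x) ≤ y * z / m - x := by
    intro x y z hx hy hz
    have h := Real.log_le_sub_one_of_pos (show 0 < y * z / (m * x) by positivity)
    rw [Real.log_div (by positivity) (by positivity), Real.log_mul hy.ne' hz.ne',
      Real.log_mul hm'.ne' hx.ne'] at h
    calc _ = x * (Real.log y + Real.log z - (Real.log m + Real.log x)) := by ring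
      _ ≤ x * (y * z / (m * x) - 1) := mul_le_mul_of_nonneg_left h hx.le
      _ = _ := by field_simp
  have k1 := mul_le_mul_of_nonneg_left (key ha hd' hd') (mul_nonneg (sub_nonneg.2 h1)
    (sub_nonneg.2 h1))
  have k2 := mul_le_mul_of_nonneg_left (key hb hd' he') (mul_nonneg (sub_nonneg.2 h1) h0)
  have k3 := mul_le_mul_of_nonneg_left (key hc he' he') (mul_nonneg h0 h0)
  -- Both weightings have total mass `m`, so the right-hand sides of `k1`, twice `k2`, and `k3`
  -- cancel.
  have hz : (1 - q) * (1 - q) * (d * d / m - a) + 2 * ((1 - q) * q * (d * e / m - b)) +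
      q * q * (e * e / m - c) = 0 := by
    have : (1 - q) * (1 - q) * (d * d / m - a) + 2 * ((1 - q) * q * (d * e / m - b)) +
      q * q * (e * e / m - c) = ((1 - q) * d + q * e) ^ 2 / m -
        ((1 - q) * d + q * e) := by
      rw [hd, he]; ring
    rw [this, ← hm]
    field_simp
    ring
  -- The prefactors are expanded in `a`, `b`, `c` while the logarithms keep `m`, `d`, `e` as atoms.
  -- The goal then becomes a linear combination of `k1`, `k2`, `k3` and `hz`.
  have expand : ∀ u, Real.negMulLog m = -(((1 - q) * ((1 - q) * a + q * b) +
      q * ((1 - q) * b + q * c)) * Real.log m) ∧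
      (u = d → Real.negMulLog u = -(((1 - q) * a + q * b) * Real.log d)) ∧
      (u = e → Real.negMulLog u = -(((1 - q) * b + q * c) * Real.log e)) := by
    intro u
    refine ⟨by rw [Real.negMulLog]; ring, ?_, ?_⟩ <;> rintro rfl <;> rw [Real.negMulLog] <;> ring
  rw [(expand d).1, (expand d).2.1 rfl, (expand e).2.2 rfl]
  simp only [Real.negMulLog]
  nlinarith [k1, k2, k3, hz]

/-- The two terms of the binary entropy belong to the two output values, and the previous inequality
applies to each. In information terms, `H(Z) + H(Z | X₁, X₂) ≤ H(Z | X₁) + H(Z | X₂)` for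
independent `X₁`, `X₂`. -/
lemma binEntropy_mix_le {q a b c : ℝ} (h0 : 0 ≤ q) (h1 : q ≤ 1)
    (ha : a ∈ Set.Ioo (0 : ℝ) 1) (hb : b ∈ Set.Ioo (0 : ℝ) 1) (hc : c ∈ Set.Ioo (0 : ℝ) 1) :
    Real.binEntropy ((1 - q) * ((1 - q) * a + q * b) + q * ((1 - q) * b + q * c)) +
      ((1 - q) * ((1 - q) * Real.binEntropy a + q * Real.binEntropy b) +
        q * ((1 - q) * Real.binEntropy b + q * Real.binEntropy c)) ≤
    2 * ((1 - q) * Real.binEntropy ((1 - q) * a + q * b) +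
      q * Real.binEntropy ((1 - q) * b + q * c)) := by
  have A := negMulLog_mix_le h0 h1 ha.1 hb.1 hc.1
  have B := negMulLog_mix_le h0 h1 (sub_pos.2 ha.2) (sub_pos.2 hb.2) (sub_pos.2 hc.2)
  simp only [Real.binEntropy_eq_negMulLog_add_negMulLog_one_sub]
  rw [show 1 - ((1 - q) * a + q * b) = (1 - q) * (1 - a) + q * (1 - b) by ring,
    show 1 - ((1 - q) * b + q * c) = (1 - q) * (1 - b) + q * (1 - c) by ring,
    show 1 - ((1 - q) * ((1 - q) * a + q * b) + q * ((1 - q) * b + q * c)) =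
      (1 - q) * ((1 - q) * (1 - a) + q * (1 - b)) + q * ((1 - q) * (1 - b) + q * (1 - c)) by ring]
  linarith

/-- A sequence that is concave up to `k` has average slope at least its average slope up to
`k`. -/
lemma mul_sub_le_mul_sub_of_concave {a : ℕ → ℝ} {k : ℕ}
    (h : ∀ i, i + 2 ≤ k → a (i + 2) + a i ≤ 2 * a (i + 1)) {i : ℕ} (hi : i ≤ k) :
    i * (a k - a 0) ≤ k * (a i - a 0) := by
  -- The next increment is at most the mean of the preceding `j` increments.
  have hd : ∀ j, j + 1 ≤ k → j * (a (j + 1) - a j) ≤ a j - a 0 := by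
    intro j
    induction j with
    | zero => simp
    | succ j ih =>
      intro hj
      have h1 := ih (by omega)
      have h2 := h j (by omega)
      push_cast
      nlinarith [mul_le_mul_of_nonneg_left h2 (Nat.cast_nonneg (α := ℝ) j)]
  have : ∀ d, i + d ≤ k → i * (a (i + d) - a 0) ≤ ((i + d : ℕ) : ℝ) * (a i - a 0) := by
    intro d
    induction d with
    | zero => simp
    | succ d ih =>
      intro hk
      have h1 := ih (by omega)
      have h2 := hd (i + d) (by omega)
      rcases Nat.eq_zero_or_pos (i + d) with h0 | h0
      · obtain rfl : i = 0 := by omega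
        simp
      · have h3 : (0 : ℝ) < ((i + d : ℕ) : ℝ) := by exact_mod_cast h0
        have e : i + (d + 1) = i + d + 1 := rfl
        rw [e]
        refine le_of_mul_le_mul_left ?_ h3
        set N : ℝ := ((i + d : ℕ) : ℝ)
        have e2 : (((i + d + 1 : ℕ)) : ℝ) = N + 1 := by push_cast [N]; ring
        rw [e2]
        have h4 := mul_le_mul_of_nonneg_left h2 (Nat.cast_nonneg (α := ℝ) i)
        nlinarith [mul_le_mul_of_nonneg_left h1 (show 0 ≤ N + 1 by linarith)]
  obtain ⟨d, rfl⟩ := Nat.exists_eq_add_of_le hi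
  exact this d le_rfl

section PartialInformation

variable {q : ℝ} {p : ℕ → ℝ}

/-- The probability of a hit when `s` active users are known to send, and `i` have unknown
preambles. -/
noncomputable def condHit (q : ℝ) (p : ℕ → ℝ) (i s : ℕ) : ℝ := binomialMean q i fun v => p (s + v)

/-- The conditional entropy, in nats, of the output given the symbols of all but `i` of the `k`
active users. -/
noncomputable def condEntropy (q : ℝ) (p : ℕ → ℝ) (k i : ℕ) : ℝ :=
  binomialMean q (k - i) fun s => Real.binEntropy (condHit q p i s)

lemma condHit_zero (s : ℕ) : condHit q p 0 s = p s := rfl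

lemma condHit_succ (i s : ℕ) :
    condHit q p (i + 1) s = (1 - q) * condHit q p i s + q * condHit q p i (s + 1) := by
  simp only [condHit, binomialMean]
  congr 3
  ext v
  congr 1
  ring

lemma condHit_mem_Ioo (h0 : 0 ≤ q) (h1 : q ≤ 1) (hp : ∀ v, p v ∈ Set.Ioo (0 : ℝ) 1)
    (i s : ℕ) : condHit q p i s ∈ Set.Ioo (0 : ℝ) 1 :=
  binomialMean_mem_Ioo h0 h1 fun _ => hp _

/-- The three entropies share an outer average over the `k - i - 2` symbols known in all of them.
Under it, the claim is the two-symbol inequality for the two users whose status changes. -/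
lemma condEntropy_concave (h0 : 0 ≤ q) (h1 : q ≤ 1) (hp : ∀ v, p v ∈ Set.Ioo (0 : ℝ) 1)
    {k i : ℕ} (hi : i + 2 ≤ k) :
    condEntropy q p k (i + 2) + condEntropy q p k i ≤ 2 * condEntropy q p k (i + 1) := by
  obtain ⟨j, rfl⟩ := Nat.exists_eq_add_of_le hi
  simp only [condEntropy]
  rw [show i + 2 + j - (i + 2) = j by omega, show i + 2 + j - i = j + 1 + 1 by omega,
    show i + 2 + j - (i + 1) = j + 1 by omega, binomialMean_succ', binomialMean_succ',
    binomialMean_succ', ← binomialMean_add, ← binomialMean_const_mul]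
  refine binomialMean_mono h0 h1 fun v _ => ?_
  have := condHit_mem_Ioo h0 h1 hp i
  simp only [condHit_succ]
  exact binEntropy_mix_le h0 h1 (this _) (this _) (this _)

/-- With `I_i` the information about `i` users given the others, this is `I_i / i ≥ I_k / k`. It
makes confusing all users at once the only binding case in achievability. -/
lemma condEntropy_sub_ge (h0 : 0 ≤ q) (h1 : q ≤ 1) (hp : ∀ v, p v ∈ Set.Ioo (0 : ℝ) 1)
    {k i : ℕ} (hi : i ≤ k) :
    i * (condEntropy q p k k - condEntropy q p k 0) ≤
      k * (condEntropy q p k i - condEntropy q p k 0) :=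
  mul_sub_le_mul_sub_of_concave (fun _ hj => condEntropy_concave h0 h1 hp hj) hi

end PartialInformation

/-! ### Complex Gaussian variables: stability and energy -/

section Gaussian

open Complex in
lemma charFun_complexGaussian (v : ℝ≥0) (t : ℂ) :
    charFun (complexGaussian v) t = cexp (-(v * ‖t‖ ^ 2 / 4 : ℝ)) := by
  have h : ∀ x : ℝ × ℝ, cexp ((inner ℝ (measurableEquivRealProd.symm x) t : ℝ) * I) =
      cexp ((t.re : ℂ) * x.1 * I) * cexp ((t.im : ℂ) * x.2 * I) := by
    intro x
    rw [← Complex.exp_add]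
    congr 1
    rw [Complex.inner]
    simp [measurableEquivRealProd_symm_apply]
    ring
  have h1 : ∀ s : ℝ, ∫ x : ℝ, cexp ((s : ℂ) * x * I) ∂(gaussianReal 0 (v / 2)) =
      cexp (-(v * s ^ 2 / 4 : ℝ)) := by
    intro s
    rw [← charFun_apply_real, charFun_gaussianReal]
    congr 1
    push_cast
    ring
  rw [charFun_apply, complexGaussian, integral_map_equiv]
  simp only [h]
  rw [integral_prod_mul (fun x : ℝ => cexp ((t.re : ℂ) * x * I))
    (fun x : ℝ => cexp ((t.im : ℂ) * x * I)), h1, h1, ← Complex.exp_add, ← normSq_eq_norm_sq,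
    normSq_apply]
  congr 1
  push_cast
  ring

instance isProbabilityMeasure_complexGaussian (v : ℝ≥0) :
    IsProbabilityMeasure (complexGaussian v) :=
  Measure.isProbabilityMeasure_map (by fun_prop)

/-- A linear combination, with nonnegative coefficients, of independent centred complex Gaussian
variables plus an independent one. -/
lemma map_sum_add_complexGaussian {ι : Type*} [Fintype ι] (c : ι → ℝ≥0) (v w : ℝ≥0) :
    ((Measure.pi fun _ : ι => complexGaussian v).prod (complexGaussian w)).map
      (fun x => ∑ i, (c i : ℝ) • x.1 i + x.2) = complexGaussian (∑ i, c i ^ 2 * v + w) := by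
  have hS : Measurable fun y : ι → ℂ => ∑ i, (c i : ℝ) • y i := by fun_prop
  have e1 : ((Measure.pi fun _ : ι => complexGaussian v).prod (complexGaussian w)).map
      (fun x => ∑ i, (c i : ℝ) • x.1 i + x.2) =
      ((((Measure.pi fun _ : ι => complexGaussian v).map
        (fun y => ∑ i, (c i : ℝ) • y i)).prod (complexGaussian w)).map fun p => p.1 + p.2) := by
    have hp := Measure.map_prod_map (Measure.pi fun _ : ι => complexGaussian v)
      (complexGaussian w) hS measurable_id
    rw [Measure.map_id] at hp
    rw [hp, Measure.map_map (by fun_prop) (by fun_prop)]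
    rfl
  have e2 : (Measure.pi fun _ : ι => complexGaussian v).map (fun y => ∑ i, (c i : ℝ) • y i) =
      (Measure.pi fun i : ι => (complexGaussian v).map ((c i : ℝ) • ·)).map
        fun y => ∑ i, y i := by
    rw [← Measure.pi_map_pi (fun i => by fun_prop),
      Measure.map_map (by fun_prop) (by fun_prop)]
    rfl
  have i1 : ∀ i, IsProbabilityMeasure ((complexGaussian v).map ((c i : ℝ) • ·)) := fun i =>
    Measure.isProbabilityMeasure_map (by fun_prop)
  have i2 : IsProbabilityMeasure ((Measure.pi fun _ : ι => complexGaussian v).map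
      (fun y => ∑ i, (c i : ℝ) • y i)) := Measure.isProbabilityMeasure_map hS.aemeasurable
  have i3 : IsProbabilityMeasure
      (((Measure.pi fun _ : ι => complexGaussian v).prod (complexGaussian w)).map
      (fun x => ∑ i, (c i : ℝ) • x.1 i + x.2)) := Measure.isProbabilityMeasure_map (by fun_prop)
  -- Characteristic functions determine the law and turn the independent sum into a product of
  -- exponentials, whose variances add.
  refine Measure.ext_of_charFun ?_
  rw [e1, charFun_map_add_prod_eq_mul, e2, charFun_map_sum_pi_eq_prod]
  ext t
  rw [Pi.mul_apply, Finset.prod_apply]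
  simp only [charFun_map_smul, charFun_complexGaussian]
  rw [← Complex.exp_sum, ← Complex.exp_add]
  congr 1
  simp only [norm_smul]
  push_cast
  simp only [Finset.sum_neg_distrib, add_mul, add_div, Finset.sum_mul, Finset.sum_div, neg_add]
  simp
  refine Finset.sum_congr rfl fun i _ => ?_
  ring

/-- The energy of a `CN(0, v)` variable is exponential with mean `v`. The density is radial, so in
polar coordinates the tail integral splits into an angular factor and an elementary radial one. -/
lemma complexGaussian_real_lt_norm_sq {v : ℝ≥0} (hv : 0 < v) {γ : ℝ} (hγ : 0 < γ) :
    (complexGaussian v).real {z | γ < ‖z‖ ^ 2} = Real.exp (-(γ / v)) := by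
  have hv' : (0 : ℝ) < v := hv
  have hS : MeasurableSet {z : ℂ | γ < ‖z‖ ^ 2} := measurableSet_lt (by fun_prop) (by fun_prop)
  have hd : complexGaussian v = (volume : Measure ℂ).withDensity fun z =>
      ENNReal.ofReal ((Real.pi * v)⁻¹ * Real.exp (-(‖z‖ ^ 2 / v))) := by
    have hv2 : v / 2 ≠ 0 := by positivity
    rw [complexGaussian, gaussianReal_of_var_ne_zero _ hv2,
      prod_withDensity (by fun_prop) (by fun_prop), ← Measure.volume_eq_prod]
    rw [← (Complex.volume_preserving_equiv_real_prod.symm).map_eq]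
    refine Measure.ext fun s hs => ?_
    rw [Measure.map_apply (by fun_prop) hs, withDensity_apply _ hs,
      withDensity_apply _ (Complex.measurableEquivRealProd.symm.measurable hs),
      MeasurableEmbedding.restrict_map (MeasurableEquiv.measurableEmbedding _),
      lintegral_map_equiv]
    refine lintegral_congr fun x => ?_
    rw [gaussianPDF, gaussianPDF, ← ENNReal.ofReal_mul (gaussianPDFReal_nonneg _ _ _),
      ← Complex.normSq_eq_norm_sq, Complex.normSq_apply]
    congr 1
    simp only [gaussianPDFReal, Complex.measurableEquivRealProd_symm_apply]
    rw [mul_mul_mul_comm, ← Real.exp_add, ← mul_inv, ← sq, Real.sq_sqrt (by positivity)]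
    congr 2
    · push_cast; ring
    · push_cast; field_simp; ring
  have hint : ∫ z in {z : ℂ | γ < ‖z‖ ^ 2}, (Real.pi * v)⁻¹ * Real.exp (-(‖z‖ ^ 2 / v)) =
      Real.exp (-(γ / v)) := by
    rw [← integral_indicator hS, ← Complex.integral_comp_polarCoord_symm]
    -- The trailing factor `1` is the function of the angle, put there so that the integral over the
    -- product domain factors.
    have hpol : ∀ p ∈ polarCoord.target, p.1 • ({z : ℂ | γ < ‖z‖ ^ 2}.indicator
        (fun z => (Real.pi * v)⁻¹ * Real.exp (-(‖z‖ ^ 2 / v))) (Complex.polarCoord.symm p)) =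
        (Set.Ioi (√γ)).indicator (fun r => r * ((Real.pi * v)⁻¹ * Real.exp (-(r ^ 2 / v)))) p.1
          * 1 := by
      rintro ⟨r, θ⟩ hp
      have hr : 0 < r := hp.1
      simp only [Set.indicator, Set.mem_ofPred_eq, Complex.norm_polarCoord_symm, sq_abs,
        Set.mem_Ioi, smul_eq_mul, Real.sqrt_lt' hr]
      split_ifs <;> simp
    rw [setIntegral_congr_fun polarCoord.open_target.measurableSet hpol, polarCoord_target,
      Measure.volume_eq_prod, setIntegral_prod_mul
        ((Set.Ioi (√γ)).indicator fun r => r * ((Real.pi * v)⁻¹ * Real.exp (-(r ^ 2 / v))))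
        (fun _ => (1 : ℝ)),
      setIntegral_indicator measurableSet_Ioi, Set.Ioi_inter_Ioi,
      sup_eq_right.2 (Real.sqrt_nonneg γ)]
    -- The constant `(2π)⁻¹` in the antiderivative cancels the length `2π` of the range of angles.
    have hder : ∀ r ∈ Set.Ici (√γ), HasDerivAt
        (fun r : ℝ => -((2 * Real.pi)⁻¹ * Real.exp (-(r ^ 2 / v))))
        (r * ((Real.pi * v)⁻¹ * Real.exp (-(r ^ 2 / v)))) r := by
      intro r _
      have := ((((hasDerivAt_pow 2 r).div_const (v : ℝ)).neg.exp).const_mul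
        ((2 * Real.pi)⁻¹)).neg
      refine this.congr_deriv ?_
      have := Real.pi_pos
      field_simp
      simp
      ring
    have hlim : Tendsto (fun r : ℝ => -((2 * Real.pi)⁻¹ * Real.exp (-(r ^ 2 / v)))) atTop
        (𝓝 0) := by
      have : Tendsto (fun r : ℝ => Real.exp (-(r ^ 2 / v))) atTop (𝓝 0) :=
        Real.tendsto_exp_neg_atTop_nhds_zero.comp
          ((tendsto_pow_atTop two_ne_zero).atTop_div_const hv')
      simpa using (this.const_mul ((2 * Real.pi)⁻¹)).neg
    rw [integral_Ioi_of_hasDerivAt_of_nonneg' hder (fun r hr => ?_) hlim, Real.sq_sqrt hγ.le]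
    · have := Real.pi_pos
      simp
      field_simp
      rw [max_eq_left (by positivity)]
      ring
    · have : 0 ≤ r := (Real.sqrt_nonneg _).trans (le_of_lt hr)
      positivity
  rw [hd, measureReal_def, withDensity_apply _ hS, ← hint,
    integral_eq_lintegral_of_nonneg_ae (ae_of_all _ fun z => by positivity)
      (by fun_prop)]

end Gaussian

/-! ### Weights of a single channel use, and counting `On` symbols -/

/-- The weight of a bit under `Bern(q)`. -/
def bitWeight (q : ℝ) (b : Bool) : ℝ := if b then q else 1 - q

/-- The number of users in `A` that send an `On` symbol. -/
def onCount {ι : Type*} (A : Finset ι) (x : ι → Bool) : ℕ := (A.filter fun i => x i = true).card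

/-- The weight of a vector of symbols under i.i.d. `Bern(q)` bits. -/
noncomputable def symbolWeight {ι : Type*} [Fintype ι] (q : ℝ) (x : ι → Bool) : ℝ :=
  ∏ i, bitWeight q (x i)

/-- The joint weight of the symbols of all users and the detector output in one channel use. -/
noncomputable def letterWeight {ι : Type*} [Fintype ι] (q : ℝ) (p : ℕ → ℝ) (A : Finset ι)
    (y : (ι → Bool) × Bool) : ℝ :=
  symbolWeight q y.1 * bitWeight (p (onCount A y.1)) y.2

section OnCount

variable {ι : Type*}

lemma onCount_congr {S : Finset ι} {x y : ι → Bool} (h : ∀ i ∈ S, x i = y i) :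
    onCount S x = onCount S y := by
  rw [onCount, onCount, Finset.filter_congr fun i hi => by rw [h i hi]]

lemma onCount_union [DecidableEq ι] {S T : Finset ι} (h : Disjoint S T) (x : ι → Bool) :
    onCount (S ∪ T) x = onCount S x + onCount T x := by
  rw [onCount, Finset.filter_union, Finset.card_union_of_disjoint]
  · rfl
  · exact Finset.disjoint_filter_filter h

end OnCount

section Counting

variable {ι : Type*} [Fintype ι] [DecidableEq ι] {q : ℝ}

lemma sum_bool_weight (r : ℝ) : ∑ b, bitWeight r b = 1 := by
  simp [bitWeight]

lemma sum_symbolWeight : ∑ x : ι → Bool, symbolWeight q x = 1 := by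
  simp only [symbolWeight, ← Fintype.prod_sum, sum_bool_weight, Finset.prod_const_one]

/-- Conditions on the symbol of user `i`. Both sums on the right still run over all symbol vectors,
which is harmless because the updated argument ignores coordinate `i`. This is the induction step
for the binomial law of `onCount`. -/
lemma sum_symbolWeight_update (i : ι) (H : (ι → Bool) → ℝ) :
    ∑ x, symbolWeight q x * H x =
      (1 - q) * ∑ x, symbolWeight q x * H (Function.update x i false) +
        q * ∑ x, symbolWeight q x * H (Function.update x i true) := by
  have hw : ∀ p : Bool × ({j // j ≠ i} → Bool),
      symbolWeight q ((Equiv.funSplitAt i Bool).symm p) =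
        bitWeight q p.1 * ∏ j, bitWeight q (p.2 j) := by
    intro p
    rw [symbolWeight, ← Finset.mul_prod_erase _ _ (Finset.mem_univ i)]
    congr 1
    · simp [Equiv.funSplitAt, Equiv.piSplitAt]
    · rw [Finset.prod_subtype (Finset.univ.erase i) (p := fun j => j ≠ i) (by simp)]
      refine Finset.prod_congr rfl fun j _ => ?_
      simp [Equiv.funSplitAt, Equiv.piSplitAt, j.2]
  have hu : ∀ (p : Bool × ({j // j ≠ i} → Bool)) (b : Bool),
      Function.update ((Equiv.funSplitAt i Bool).symm p) i b =
        (Equiv.funSplitAt i Bool).symm (b, p.2) := by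
    intro p b
    ext j
    by_cases hj : j = i
    · subst hj; simp [Equiv.funSplitAt, Equiv.piSplitAt]
    · simp [Equiv.funSplitAt, Equiv.piSplitAt, hj]
  have e : ∀ G : (ι → Bool) → ℝ, ∑ x, G x =
      ∑ y, G ((Equiv.funSplitAt i Bool).symm (true, y)) +
        ∑ y, G ((Equiv.funSplitAt i Bool).symm (false, y)) := by
    intro G
    rw [← (Equiv.funSplitAt i Bool).symm.sum_comp, Fintype.sum_prod_type, Fintype.sum_bool]
  rw [e, e (fun x => symbolWeight q x * H (Function.update x i false)),
    e (fun x => symbolWeight q x * H (Function.update x i true))]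
  simp only [hw, hu]
  simp only [bitWeight, if_true, Bool.false_eq_true, if_false, mul_assoc, ← Finset.mul_sum]
  ring

/-- The number of `On` symbols in `S` is binomial, and independent of the other symbols. -/
lemma sum_symbolWeight_onCount (S : Finset ι) (F : ℕ → (ι → Bool) → ℝ)
    (hF : ∀ n x y, (∀ i, i ∉ S → x i = y i) → F n x = F n y) :
    ∑ x, symbolWeight q x * F (onCount S x) x =
      binomialMean q S.card fun n => ∑ x, symbolWeight q x * F n x := by
  induction S using Finset.induction_on generalizing F with
  | empty => simp [onCount, binomialMean]
  | insert i S hi ih =>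
    have hup : ∀ (b : Bool) n x, F n (Function.update x i b) = F n x := by
      intro b n x
      refine hF n _ _ fun j hj => ?_
      rw [Function.update_of_ne]
      rintro rfl
      exact hj (Finset.mem_insert_self _ _)
    have hS : ∀ (b : Bool) x, onCount S (Function.update x i b) = onCount S x := by
      intro b x
      refine onCount_congr fun j hj => ?_
      rw [Function.update_of_ne]
      rintro rfl
      exact hi hj
    have hins : ∀ x, onCount (insert i S) x = onCount S x + if x i = true then 1 else 0 := by
      intro x
      rw [onCount, Finset.filter_insert]
      split_ifs with h
      · rw [Finset.card_insert_of_notMem (by simp [hi])]; rfl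
      · rfl
    have hF' : ∀ c n x y, (∀ i, i ∉ S → x i = y i) → F (n + c) x = F (n + c) y :=
      fun c n x y h => hF _ x y fun j hj => h j fun h' => hj (Finset.mem_insert_of_mem h')
    rw [sum_symbolWeight_update i, Finset.card_insert_of_notMem hi, binomialMean]
    simp only [hins, hS, hup, Function.update_self, if_true, Bool.false_eq_true, if_false]
    rw [ih (fun n x => F (n + 0) x) (hF' 0), ih (fun n x => F (n + 1) x) (hF' 1)]
    rfl

lemma sum_symbolWeight_onCount_one (S : Finset ι) (f : ℕ → ℝ) :
    ∑ x, symbolWeight q x * f (onCount S x) = binomialMean q S.card f := by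
  rw [sum_symbolWeight_onCount S (fun n _ => f n) fun _ _ _ _ => rfl]
  simp only [← Finset.sum_mul, sum_symbolWeight, one_mul]

lemma sum_symbolWeight_onCount_two {S T : Finset ι} (h : Disjoint S T) (f : ℕ → ℕ → ℝ) :
    ∑ x, symbolWeight q x * f (onCount S x) (onCount T x) =
      binomialMean q S.card fun u => binomialMean q T.card fun v => f u v := by
  rw [sum_symbolWeight_onCount S (fun n x => f n (onCount T x)) fun n x y hxy => by
    rw [onCount_congr fun i hi => hxy i (Finset.disjoint_right.1 h hi)]]
  simp only [sum_symbolWeight_onCount_one]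

lemma sum_symbolWeight_onCount_three {S T U : Finset ι} (hST : Disjoint S T) (hSU : Disjoint S U)
    (hTU : Disjoint T U) (f : ℕ → ℕ → ℕ → ℝ) :
    ∑ x, symbolWeight q x * f (onCount S x) (onCount T x) (onCount U x) =
      binomialMean q S.card fun u => binomialMean q T.card fun v =>
        binomialMean q U.card fun w => f u v w := by
  rw [sum_symbolWeight_onCount S (fun n x => f n (onCount T x) (onCount U x)) fun n x y hxy => by
    rw [onCount_congr fun i hi => hxy i (Finset.disjoint_right.1 hST hi),
      onCount_congr fun i hi => hxy i (Finset.disjoint_right.1 hSU hi)]]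
  simp only [sum_symbolWeight_onCount_two hTU]

end Counting

/-! ### Sums over words of i.i.d. letters -/

section Product

variable {Y : Type*} [Fintype Y] {n : ℕ}

lemma sum_prod_eq_pow (f : Y → ℝ) : ∑ y : Fin n → Y, ∏ t, f (y t) = (∑ a, f a) ^ n := by
  classical
  rw [← Fintype.prod_sum, Finset.prod_const, Finset.card_univ, Fintype.card_fin]

/-- The mean of a sum over i.i.d. letters. -/
lemma sum_prod_mul_sum (f g : Y → ℝ) (hf : ∑ a, f a = 1) :
    ∑ y : Fin n → Y, (∏ t, f (y t)) * ∑ t, g (y t) = n * ∑ a, f a * g a := by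
  classical
  have h : ∀ s : Fin n, ∑ y : Fin n → Y, (∏ t, f (y t)) * g (y s) = ∑ a, f a * g a := by
    intro s
    -- The single factor `g (y s)` is spread as a product that is trivial away from `s`, so that sum
    -- and product can be exchanged.
    calc _ = ∑ y : Fin n → Y, ∏ t, f (y t) * (if t = s then g (y t) else 1) := by
          refine Finset.sum_congr rfl fun y _ => ?_
          rw [Finset.prod_mul_distrib, Finset.prod_ite_eq' Finset.univ s]
          simp
      _ = ∏ t : Fin n, ∑ a, f a * (if t = s then g a else 1) := by
          rw [Fintype.prod_sum (fun t a => f a * (if t = s then g a else 1))]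
      _ = ∏ t : Fin n, if t = s then ∑ a, f a * g a else 1 := by
          refine Finset.prod_congr rfl fun t _ => ?_
          split_ifs <;> simp [hf]
      _ = _ := by simp
  simp only [Finset.mul_sum]
  rw [Finset.sum_comm]
  simp [h, Finset.mul_sum]

end Product

/-! ### From the physical channel to a memoryless discrete one -/

section Channel

variable {P σ σw : ℝ≥0} {ℓ n : ℕ}

instance isProbabilityMeasure_preambleLaw (q : unitInterval) :
    IsProbabilityMeasure (preambleLaw ℓ n q) := by
  unfold preambleLaw; infer_instance

instance isProbabilityMeasure_fadingLaw : IsProbabilityMeasure (fadingLaw σ ℓ n) := by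
  unfold fadingLaw; infer_instance

instance isProbabilityMeasure_noiseLaw : IsProbabilityMeasure (noiseLaw σw n) := by
  unfold noiseLaw; infer_instance

instance isProbabilityMeasure_channelLaw (q : unitInterval) :
    IsProbabilityMeasure (channelLaw σ σw ℓ n q) := by
  unfold channelLaw; infer_instance

/-- The received symbol in one channel use, as a function of the symbols of all users, the fading
coefficients and the noise in that channel use. -/
noncomputable def receivedSymbol (P : ℝ≥0) (A : Finset (Fin ℓ)) (x : Fin ℓ → Bool)
    (y : (Fin ℓ → ℂ) × ℂ) : ℂ :=
  ∑ i, (activity A i * y.1 i) * ookSymbol P (x i) + y.2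

lemma measurable_receivedSymbol (A : Finset (Fin ℓ)) (x : Fin ℓ → Bool) :
    Measurable (receivedSymbol P A x) := by
  unfold receivedSymbol
  fun_prop

lemma received_eq (A : Finset (Fin ℓ)) (X : Preambles ℓ n) (h : Fin n → Fin ℓ → ℂ)
    (w : Fin n → ℂ) (t : Fin n) :
    received P A X h w t = receivedSymbol P A (fun i => X i t) (h t, w t) := rfl

/-- Given the symbols sent, the received symbol is `CN(0, v σ² P + σ_w²)`, where `v` active users
send an `On` symbol. -/
lemma map_receivedSymbol (A : Finset (Fin ℓ)) (x : Fin ℓ → Bool) :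
    ((Measure.pi fun _ : Fin ℓ => complexGaussian (σ ^ 2)).prod (complexGaussian (σw ^ 2))).map
      (receivedSymbol P A x) = complexGaussian (onCount A x * σ ^ 2 * P + σw ^ 2) := by
  have h := map_sum_add_complexGaussian
    -- Activity and on-off keying merge into one nonnegative coefficient: `√P` for an active user
    -- sending `On`, and `0` for any other user.
    (fun i : Fin ℓ => if i ∈ A ∧ x i = true then NNReal.sqrt P else 0) (σ ^ 2) (σw ^ 2)
  have e : receivedSymbol P A x = fun y : (Fin ℓ → ℂ) × ℂ =>
      ∑ i, (((if i ∈ A ∧ x i = true then NNReal.sqrt P else 0 : ℝ≥0) : ℝ)) • y.1 i + y.2 := by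
    ext1 y
    rw [receivedSymbol]
    congr 1
    refine Finset.sum_congr rfl fun i _ => ?_
    by_cases hi : i ∈ A <;> cases hx : x i <;>
      simp [activity, ookSymbol, hi, mul_comm]
  rw [e, h]
  congr 2
  have : ∀ i, (if i ∈ A ∧ x i = true then NNReal.sqrt P else 0) ^ 2 * σ ^ 2 =
      if i ∈ A.filter (fun i => x i = true) then P * σ ^ 2 else 0 := by
    intro i
    simp only [Finset.mem_filter]
    split_ifs <;> simp
  simp only [this]
  rw [Finset.sum_ite_mem, Finset.univ_inter, Finset.sum_const, nsmul_eq_mul, onCount]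
  ring

lemma hitProb_mem_Ioo (hσw : 0 < σw) {γ : ℝ} (hγ : 0 < γ) (v : ℕ) :
    hitProb P σ σw γ v ∈ Set.Ioo (0 : ℝ) 1 := by
  have : (0 : ℝ) < σw := hσw
  refine ⟨Real.exp_pos _, ?_⟩
  rw [hitProb, Real.exp_lt_one_iff, neg_lt_zero]
  positivity

open Classical in
lemma measure_output_symbol (hσw : 0 < σw) {γ : ℝ} (hγ : 0 < γ) (A : Finset (Fin ℓ))
    (x : Fin ℓ → Bool) (z : Bool) :
    ((Measure.pi fun _ : Fin ℓ => complexGaussian (σ ^ 2)).prod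
      (complexGaussian (σw ^ 2))).real {y | decide (γ < ‖receivedSymbol P A x y‖ ^ 2) = z} =
      bitWeight (hitProb P σ σw γ (onCount A x)) z := by
  set μ := (Measure.pi fun _ : Fin ℓ => complexGaussian (σ ^ 2)).prod (complexGaussian (σw ^ 2))
  have hm := measurable_receivedSymbol (P := P) A x
  have hS : MeasurableSet {s : ℂ | γ < ‖s‖ ^ 2} := measurableSet_lt (by fun_prop) (by fun_prop)
  have h1 : μ.real (receivedSymbol P A x ⁻¹' {s | γ < ‖s‖ ^ 2}) =
      hitProb P σ σw γ (onCount A x) := by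
    rw [← map_measureReal_apply hm hS, map_receivedSymbol,
      complexGaussian_real_lt_norm_sq (by positivity) hγ, hitProb]
    simp
  cases z
  · have : {y | decide (γ < ‖receivedSymbol P A x y‖ ^ 2) = false} =
        (receivedSymbol P A x ⁻¹' {s | γ < ‖s‖ ^ 2})ᶜ := by
      ext y; simp
    rw [this, probReal_compl_eq_one_sub (hm hS), h1]
    simp [bitWeight]
  · have : {y | decide (γ < ‖receivedSymbol P A x y‖ ^ 2) = true} =
        receivedSymbol P A x ⁻¹' {s | γ < ‖s‖ ^ 2} := by
      ext y; simp
    rw [this, h1]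
    simp [bitWeight]

lemma preambleLaw_real_singleton (q : unitInterval) (X : Preambles ℓ n) :
    (preambleLaw ℓ n q).real {X} = ∏ t, symbolWeight (q : ℝ) fun i => X i t := by
  simp only [symbolWeight]
  rw [Finset.prod_comm, measureReal_def, preambleLaw, Measure.pi_singleton, ENNReal.toReal_prod]
  refine Finset.prod_congr rfl fun i _ => ?_
  rw [Measure.pi_singleton, ENNReal.toReal_prod]
  refine Finset.prod_congr rfl fun t _ => ?_
  rw [← measureReal_def]
  cases X i t <;> simp [bitWeight]

open Classical in
lemma measurableSet_output_symbol (γ : ℝ) (A : Finset (Fin ℓ)) (x : Fin ℓ → Bool) (z : Bool) :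
    MeasurableSet {y | decide (γ < ‖receivedSymbol P A x y‖ ^ 2) = z} := by
  have hm := ((measurable_receivedSymbol (P := P) A x).norm.pow_const 2)
  cases z
  · simpa only [decide_eq_false_iff_not, not_lt] using measurableSet_le hm measurable_const
  · simpa only [decide_eq_true_eq] using measurableSet_lt (measurable_const (a := γ)) hm

-- When fading and noise are regrouped by channel use, prescribing the outputs defines a box. This
-- is why the product measure factors over channel uses.
open Classical in
lemma preimage_output (γ : ℝ) (A : Finset (Fin ℓ)) (X : Preambles ℓ n) (z : Fin n → Bool) :
    (MeasurableEquiv.arrowProdEquivProdArrow (Fin ℓ → ℂ) ℂ (Fin n)) ⁻¹'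
      {y | output P γ A X y.1 y.2 = z} = Set.univ.pi fun t =>
      {y : (Fin ℓ → ℂ) × ℂ |
        decide (γ < ‖receivedSymbol P A (fun i => X i t) y‖ ^ 2) = z t} := by
  ext y
  simp only [Set.mem_preimage, Set.mem_ofPred_eq, Set.mem_pi, Set.mem_univ, true_imp_iff]
  rw [funext_iff]
  refine forall_congr' fun t => ?_
  rw [output, received_eq]
  rfl

lemma setOf_preambles_output (γ : ℝ) (A : Finset (Fin ℓ)) (X : Preambles ℓ n)
    (z : Fin n → Bool) :
    {ω : Preambles ℓ n × (Fin n → Fin ℓ → ℂ) × (Fin n → ℂ) |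
      ω.1 = X ∧ output P γ A ω.1 ω.2.1 ω.2.2 = z} =
      {X} ×ˢ {y | output P γ A X y.1 y.2 = z} := by
  ext ⟨X', h, w⟩
  simp only [Set.mem_ofPred_eq, Set.mem_prod, Set.mem_singleton_iff]
  constructor <;> rintro ⟨rfl, h⟩ <;> exact ⟨rfl, h⟩

lemma measurableSet_preambles_output (γ : ℝ) (A : Finset (Fin ℓ)) (X : Preambles ℓ n)
    (z : Fin n → Bool) :
    MeasurableSet {ω : Preambles ℓ n × (Fin n → Fin ℓ → ℂ) × (Fin n → ℂ) |
      ω.1 = X ∧ output P γ A ω.1 ω.2.1 ω.2.2 = z} := by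
  rw [setOf_preambles_output]
  refine (measurableSet_singleton X).prod ?_
  rw [← MeasurableEquiv.measurableSet_preimage
    (MeasurableEquiv.arrowProdEquivProdArrow (Fin ℓ → ℂ) ℂ (Fin n)), preimage_output]
  exact MeasurableSet.univ_pi fun t => measurableSet_output_symbol _ _ _ _

/-- The law of the preambles and the detector outputs is memoryless. -/
lemma channelLaw_real_preambles_output (hσw : 0 < σw) {γ : ℝ} (hγ : 0 < γ) (q : unitInterval)
    (A : Finset (Fin ℓ)) (X : Preambles ℓ n) (z : Fin n → Bool) :
    (channelLaw σ σw ℓ n q).real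
      {ω | ω.1 = X ∧ output P γ A ω.1 ω.2.1 ω.2.2 = z} =
      ∏ t, letterWeight (q : ℝ) (hitProb P σ σw γ) A (fun i => X i t, z t) := by
  have hp := measurePreserving_arrowProdEquivProdArrow (Fin ℓ → ℂ) ℂ (Fin n)
    (fun _ => Measure.pi fun _ => complexGaussian (σ ^ 2)) (fun _ => complexGaussian (σw ^ 2))
  have hfn : ((fadingLaw σ ℓ n).prod (noiseLaw σw n)).real {y | output P γ A X y.1 y.2 = z} =
      ∏ t, bitWeight (hitProb P σ σw γ (onCount A fun i => X i t)) (z t) := by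
    rw [measureReal_def, fadingLaw, noiseLaw, ← hp.measure_preimage_equiv, preimage_output,
      Measure.pi_pi, ENNReal.toReal_prod]
    refine Finset.prod_congr rfl fun t _ => ?_
    rw [← measureReal_def, measure_output_symbol hσw hγ]
  rw [setOf_preambles_output, channelLaw, measureReal_prod_prod, preambleLaw_real_singleton, hfn,
    ← Finset.prod_mul_distrib]
  rfl

/-- The preambles that a sequence of symbol vectors consists of. -/
def toPreambles (y : Fin n → (Fin ℓ → Bool) × Bool) : Preambles ℓ n := fun i t => (y t).1 i

/-- The detector outputs in a sequence of letters. -/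
def toOutputs (y : Fin n → (Fin ℓ → Bool) × Bool) : Fin n → Bool := fun t => (y t).2

-- Preambles and outputs take finitely many values, so any event expressed through them is a finite
-- disjoint union of events of known probability. Thus `D` needs no measurability assumption.
open Classical in
lemma channelLaw_real_eq_sum (hσw : 0 < σw) {γ : ℝ} (hγ : 0 < γ) (q : unitInterval)
    (A : Finset (Fin ℓ)) (D : Preambles ℓ n → (Fin n → Bool) → Prop) :
    (channelLaw σ σw ℓ n q).real {ω | D ω.1 (output P γ A ω.1 ω.2.1 ω.2.2)} =
      ∑ y : Fin n → (Fin ℓ → Bool) × Bool,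
        (∏ t, letterWeight (q : ℝ) (hitProb P σ σw γ) A (y t)) *
          if D (toPreambles y) (toOutputs y) then 1 else 0 := by
  have e : {ω : Preambles ℓ n × (Fin n → Fin ℓ → ℂ) × (Fin n → ℂ) |
      D ω.1 (output P γ A ω.1 ω.2.1 ω.2.2)} =
      ⋃ y ∈ Finset.univ.filter fun y : Fin n → (Fin ℓ → Bool) × Bool =>
        D (toPreambles y) (toOutputs y),
        {ω | ω.1 = toPreambles y ∧ output P γ A ω.1 ω.2.1 ω.2.2 = toOutputs y} := by
    ext ω
    simp only [Set.mem_ofPred_eq, Set.mem_iUnion, Finset.mem_filter, Finset.mem_univ, true_and,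
      exists_prop]
    constructor
    · intro h
      exact ⟨fun t => (fun i => ω.1 i t, output P γ A ω.1 ω.2.1 ω.2.2 t), h, rfl, rfl⟩
    · rintro ⟨y, hy, h1, h2⟩
      rw [h2, h1]
      exact hy
  rw [e, measureReal_biUnion_finset]
  · rw [Finset.sum_filter]
    refine Finset.sum_congr rfl fun y _ => ?_
    split_ifs
    · rw [channelLaw_real_preambles_output hσw hγ, mul_one]
      rfl
    · rw [mul_zero]
  · intro y _ y' _ hne
    refine Set.disjoint_left.2 fun ω h h' => hne ?_
    have h1 := h.1.symm.trans h'.1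
    have h2 := h.2.symm.trans h'.2
    funext t
    exact Prod.ext (funext fun i => congrFun (congrFun h1 i) t) (congrFun h2 t)
  · exact fun y _ => measurableSet_preambles_output _ _ _ _

end Channel

/-! ### Information density of a letter -/

lemma bitWeight_pos {r : ℝ} (hr : r ∈ Set.Ioo (0 : ℝ) 1) (z : Bool) : 0 < bitWeight r z := by
  cases z
  · simpa [bitWeight] using hr.2
  · simpa [bitWeight] using hr.1

lemma bitWeight_nonneg {r : ℝ} (h0 : 0 ≤ r) (h1 : r ≤ 1) (z : Bool) : 0 ≤ bitWeight r z := by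
  cases z <;> simpa [bitWeight]

lemma symbolWeight_nonneg {ι : Type*} [Fintype ι] {q : ℝ} (h0 : 0 ≤ q) (h1 : q ≤ 1)
    (x : ι → Bool) : 0 ≤ symbolWeight q x :=
  Finset.prod_nonneg fun _ _ => bitWeight_nonneg h0 h1 _

lemma letterWeight_nonneg {ι : Type*} [Fintype ι] {q : ℝ} {p : ℕ → ℝ} (h0 : 0 ≤ q) (h1 : q ≤ 1)
    (hp : ∀ v, p v ∈ Set.Ioo (0 : ℝ) 1) (A : Finset ι) (a : (ι → Bool) × Bool) :
    0 ≤ letterWeight q p A a :=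
  mul_nonneg (symbolWeight_nonneg h0 h1 _) (bitWeight_pos (hp _) _).le

/-- The information density, in nats, of the symbols of the users in `A \ S` and the output, given
the symbols of the users in `S`. -/
noncomputable def letterInfo {ι : Type*} [DecidableEq ι] (q : ℝ) (p : ℕ → ℝ) (A S : Finset ι)
    (a : (ι → Bool) × Bool) : ℝ :=
  Real.log (bitWeight (p (onCount A a.1)) a.2) -
    Real.log (bitWeight (condHit q p (A \ S).card (onCount S a.1)) a.2)

lemma letterInfo_eq {ι : Type*} [DecidableEq ι] {q : ℝ} {p : ℕ → ℝ} {A S : Finset ι} (hS : S ⊆ A)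
    (a : (ι → Bool) × Bool) :
    letterInfo q p A S a =
      Real.log (bitWeight (p (onCount S a.1 + onCount (A \ S) a.1)) a.2) -
      Real.log (bitWeight (condHit q p (A \ S).card (onCount S a.1)) a.2) := by
  rw [← onCount_union Finset.disjoint_sdiff, Finset.union_sdiff_of_subset hS, letterInfo]

section Letters

variable {ι : Type*} [Fintype ι] [DecidableEq ι] {q : ℝ} {p : ℕ → ℝ}

lemma sum_letterWeight (A : Finset ι) : ∑ a, letterWeight q p A a = 1 := by
  rw [Fintype.sum_prod_type]
  simp only [letterWeight, ← Finset.mul_sum, sum_bool_weight, mul_one, sum_symbolWeight]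

/-- The means of functions of the output and of the numbers of `On` symbols sent by two
complementary sets of active users. -/
lemma sum_letterWeight_mul {A S : Finset ι} (hS : S ⊆ A) (φ : ℕ → ℕ → Bool → ℝ) :
    ∑ a, letterWeight q p A a * φ (onCount S a.1) (onCount (A \ S) a.1) a.2 =
      binomialMean q S.card fun u => binomialMean q (A \ S).card fun v =>
        ∑ z, bitWeight (p (u + v)) z * φ u v z := by
  rw [← sum_symbolWeight_onCount_two Finset.disjoint_sdiff, Fintype.sum_prod_type]
  refine Finset.sum_congr rfl fun x _ => ?_
  rw [Finset.mul_sum]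
  refine Finset.sum_congr rfl fun z _ => ?_
  rw [letterWeight, ← onCount_union Finset.disjoint_sdiff, Finset.union_sdiff_of_subset hS]
  ring

/-- The relative entropy of two Bernoulli laws, written as cross entropy minus entropy. -/
lemma sum_bitWeight_mul_log_sub {r s : ℝ} :
    ∑ z, bitWeight r z * (Real.log (bitWeight r z) - Real.log (bitWeight s z)) =
      -(r * Real.log s + (1 - r) * Real.log (1 - s)) - Real.binEntropy r := by
  rw [Fintype.sum_bool, Real.binEntropy_eq_negMulLog_add_negMulLog_one_sub]
  simp only [bitWeight, if_true, Bool.false_eq_true, if_false, Real.negMulLog]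
  ring

/-- The logarithms of `condHit` depend on `u` only, so averaging the cross entropy over `v` replaces
`p (u + v)` by its mean `condHit q p i u` and yields the entropy of that mean. -/
lemma binomialMean_log_sub (j i : ℕ) :
    (binomialMean q j fun u => binomialMean q i fun v => ∑ z, bitWeight (p (u + v)) z *
      (Real.log (bitWeight (p (u + v)) z) - Real.log (bitWeight (condHit q p i u) z))) =
      condEntropy q p (j + i) i - condEntropy q p (j + i) 0 := by
  simp only [sum_bitWeight_mul_log_sub, condEntropy, condHit_zero]
  rw [Nat.sub_zero, Nat.add_sub_cancel, binomialMean_add_trials, ← binomialMean_sub]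
  refine binomialMean_congr fun u _ => ?_
  rw [binomialMean_sub]
  congr 1
  have h2 : ∀ v, -(p (u + v) * Real.log (condHit q p i u) +
      (1 - p (u + v)) * Real.log (1 - condHit q p i u)) =
      -Real.log (1 - condHit q p i u) +
      p (u + v) * (Real.log (1 - condHit q p i u) - Real.log (condHit q p i u)) :=
    fun v => by ring
  simp only [h2]
  rw [binomialMean_add, binomialMean_const, binomialMean_mul_const, ← condHit,
    Real.binEntropy_eq_negMulLog_add_negMulLog_one_sub]
  simp only [Real.negMulLog]
  ring

/-- The mean of the information density is the conditional mutual information. -/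
lemma sum_letterWeight_mul_letterInfo {A S : Finset ι} (hS : S ⊆ A) :
    ∑ a, letterWeight q p A a * letterInfo q p A S a =
      condEntropy q p A.card (A \ S).card - condEntropy q p A.card 0 := by
  simp only [letterInfo_eq hS]
  rw [sum_letterWeight_mul hS fun u v z => Real.log (bitWeight (p (u + v)) z) -
    Real.log (bitWeight (condHit q p (A \ S).card u) z), binomialMean_log_sub,
    add_comm S.card, Finset.card_sdiff_add_card_eq_card hS]

/-- Change of measure: multiplying by the inverse likelihood ratio turns the output law `r` into
`s`. -/
lemma bitWeight_mul_exp_neg_log_sub {r s : ℝ} (hr : r ∈ Set.Ioo (0 : ℝ) 1)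
    (hs : s ∈ Set.Ioo (0 : ℝ) 1) (z : Bool) :
    bitWeight r z * Real.exp (-(Real.log (bitWeight r z) - Real.log (bitWeight s z))) =
      bitWeight s z := by
  have := bitWeight_pos hr z
  rw [neg_sub, Real.exp_sub, Real.exp_log (bitWeight_pos hs z), Real.exp_log this]
  field_simp

end Letters

/-! ### Converse: Fano's inequality -/

section Converse

variable {P σ σw : ℝ≥0} {ℓ k n : ℕ}

lemma errorProb_eq_sum (hσw : 0 < σw) (s : Scheme ℓ k n) :
    errorProb P σ σw s = 1 / (ℓ.choose k : ℝ) *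
      ∑ A ∈ Finset.powersetCard k (Finset.univ : Finset (Fin ℓ)),
        ∑ y : Fin n → (Fin ℓ → Bool) × Bool,
          (∏ t, letterWeight (s.q : ℝ) (hitProb P σ σw s.γ) A (y t)) *
            if s.detect (toPreambles y) (toOutputs y) ≠ A then 1 else 0 := by
  rw [errorProb]
  congr 1
  refine Finset.sum_congr rfl fun A _ => ?_
  convert channelLaw_real_eq_sum hσw s.γ_pos s.q A fun X z => s.detect X z ≠ A

/-- **Fano's inequality** for a memoryless channel: a decoder of a uniform message, among `M`
sets of `k` users, is correct with probability at most `(n I + log 2) / log M`. -/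
lemma sum_correct_mul_log_le {ι : Type*} [Fintype ι] [DecidableEq ι] {q : ℝ} {p : ℕ → ℝ}
    (h0 : 0 ≤ q) (h1 : q ≤ 1) (hp : ∀ v, p v ∈ Set.Ioo (0 : ℝ) 1) {k n : ℕ}
    (𝒜 : Finset (Finset ι)) (h𝒜 : ∀ A ∈ 𝒜, A.card = k) (hne : 𝒜.Nonempty)
    (d : (Fin n → (ι → Bool) × Bool) → Finset ι) :
    (∑ A ∈ 𝒜, ∑ y : Fin n → (ι → Bool) × Bool,
      (∏ t, letterWeight q p A (y t)) * if d y = A then 1 else 0) * Real.log 𝒜.card ≤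
    𝒜.card * (n * (condEntropy q p k k - condEntropy q p k 0) + Real.log 2) := by
  set M : ℝ := (𝒜.card : ℝ) with hM
  have hM0 : 0 < M := by rw [hM]; exact_mod_cast hne.card_pos
  set I := condEntropy q p k k - condEntropy q p k 0 with hI
  set m := condHit q p k 0 with hm
  have hm' : m ∈ Set.Ioo (0 : ℝ) 1 := condHit_mem_Ioo h0 h1 hp k 0
  -- Reference law with the same symbols but an output independent of them, drawn from its marginal.
  -- It does not depend on `A`.
  set r : (ι → Bool) × Bool → ℝ := fun a => symbolWeight q a.1 * bitWeight m a.2 with hr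
  have hr0 : ∀ a, 0 ≤ r a := fun a =>
    mul_nonneg (symbolWeight_nonneg h0 h1 _) (bitWeight_pos hm' _).le
  have hr1 : ∑ a, r a = 1 := by
    rw [Fintype.sum_prod_type]
    simp only [hr, ← Finset.mul_sum, sum_bool_weight, mul_one, sum_symbolWeight]
  have hry : ∑ y : Fin n → (ι → Bool) × Bool, ∏ t, r (y t) = 1 := by
    rw [sum_prod_eq_pow, hr1, one_pow]
  have hone : ∀ A ∈ 𝒜,
      (∑ y : Fin n → (ι → Bool) × Bool,
        (∏ t, letterWeight q p A (y t)) * if d y = A then 1 else 0) * Real.log M -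
        n * I - Real.log 2 ≤
      (1 / 2) * (1 + M * ∑ y : Fin n → (ι → Bool) × Bool,
        (∏ t, r (y t)) * if d y = A then 1 else 0) - 1 := by
    intro A hA
    have hcard := h𝒜 A hA
    have hw1 : ∑ y : Fin n → (ι → Bool) × Bool, ∏ t, letterWeight q p A (y t) = 1 := by
      rw [sum_prod_eq_pow, sum_letterWeight, one_pow]
    have hmean : ∑ y : Fin n → (ι → Bool) × Bool, (∏ t, letterWeight q p A (y t)) *
        ∑ t, letterInfo q p A ∅ (y t) = n * I := by
      rw [sum_prod_mul_sum _ _ (sum_letterWeight A),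
        sum_letterWeight_mul_letterInfo (Finset.empty_subset A), Finset.sdiff_empty, hcard]
    have hletter : ∀ a, letterWeight q p A a * Real.exp (-letterInfo q p A ∅ a) = r a := by
      intro a
      have : letterInfo q p A ∅ a = Real.log (bitWeight (p (onCount A a.1)) a.2) -
          Real.log (bitWeight m a.2) := by
        rw [letterInfo, Finset.sdiff_empty, hcard]
        rfl
      rw [this, letterWeight, mul_assoc, bitWeight_mul_exp_neg_log_sub (hp _) hm']
    have hy : ∀ y : Fin n → (ι → Bool) × Bool,
        (∏ t, letterWeight q p A (y t)) * ((if d y = A then 1 else 0) * Real.log M -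
          ∑ t, letterInfo q p A ∅ (y t) - Real.log 2) ≤
        (1 / 2) * ((∏ t, r (y t)) + M * ((∏ t, r (y t)) * if d y = A then 1 else 0)) -
          ∏ t, letterWeight q p A (y t) := by
      intro y
      have hw0 : 0 ≤ ∏ t, letterWeight q p A (y t) :=
        Finset.prod_nonneg fun t _ => letterWeight_nonneg h0 h1 hp _ _
      have hR0 : 0 ≤ ∏ t, r (y t) := Finset.prod_nonneg fun t _ => hr0 _
      -- Fano's inequality comes from `1 + u ≤ exp u`. The term `log 2` in `u` supplies the factor
      -- `1 / 2` that makes the right-hand sides, summed over the messages, at most `0`.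
      set u := (if d y = A then 1 else 0) * Real.log M -
          ∑ t, letterInfo q p A ∅ (y t) - Real.log 2 with hu
      have hexp : (∏ t, letterWeight q p A (y t)) * Real.exp u =
          (1 / 2) * ((∏ t, r (y t)) * Real.exp ((if d y = A then 1 else 0) * Real.log M)) := by
        have : (∏ t, letterWeight q p A (y t)) * Real.exp (-∑ t, letterInfo q p A ∅ (y t)) =
            ∏ t, r (y t) := by
          rw [← Finset.sum_neg_distrib, Real.exp_sum, ← Finset.prod_mul_distrib]
          exact Finset.prod_congr rfl fun t _ => hletter _
        rw [hu, sub_eq_add_neg, Real.exp_add, Real.exp_neg, Real.exp_log two_pos, sub_eq_add_neg,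
          Real.exp_add, ← this]
        ring
      have hle : Real.exp ((if d y = A then 1 else 0) * Real.log M) ≤
          1 + M * if d y = A then 1 else 0 := by
        split_ifs
        · rw [one_mul, Real.exp_log hM0]; linarith
        · simp
      calc _ ≤ (∏ t, letterWeight q p A (y t)) * (Real.exp u - 1) :=
            mul_le_mul_of_nonneg_left (by linarith [Real.add_one_le_exp u]) hw0
        _ = (1 / 2) * ((∏ t, r (y t)) * Real.exp ((if d y = A then 1 else 0) * Real.log M)) -
            ∏ t, letterWeight q p A (y t) := by rw [mul_sub, hexp, mul_one]
        _ ≤ (1 / 2) * ((∏ t, r (y t)) * (1 + M * if d y = A then 1 else 0)) -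
            ∏ t, letterWeight q p A (y t) := by gcongr
        _ = _ := by ring
    have hsum := Finset.sum_le_sum fun y (_ : y ∈ Finset.univ) => hy y
    rw [Finset.sum_sub_distrib, hw1, ← Finset.mul_sum, Finset.sum_add_distrib, hry,
      ← Finset.mul_sum] at hsum
    refine le_trans (le_of_eq ?_) hsum
    simp only [mul_sub, Finset.sum_sub_distrib]
    rw [hmean, ← Finset.sum_mul, hw1, one_mul, Finset.sum_mul]
    congr 2
    exact Finset.sum_congr rfl fun y _ => by ring
  have hsum := Finset.sum_le_sum hone
  -- The reference law is common to all messages and the decoding regions are disjoint, so their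
  -- total probability is at most one.
  have hdec : ∑ A ∈ 𝒜, ∑ y : Fin n → (ι → Bool) × Bool,
      (∏ t, r (y t)) * (if d y = A then (1 : ℝ) else 0) ≤ 1 := by
    rw [Finset.sum_comm]
    refine (Finset.sum_le_sum fun y _ => ?_).trans_eq hry
    rw [← Finset.mul_sum]
    have hle : ∑ A ∈ 𝒜, (if d y = A then (1 : ℝ) else 0) ≤ 1 := by
      rw [Finset.sum_ite_eq]
      split_ifs <;> norm_num
    exact mul_le_of_le_one_right (Finset.prod_nonneg fun t _ => hr0 _) hle
  simp only [Finset.sum_sub_distrib, ← Finset.sum_mul, ← Finset.mul_sum, Finset.sum_add_distrib,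
    Finset.sum_const, nsmul_eq_mul] at hsum
  rw [← hM] at hsum
  nlinarith [mul_le_mul_of_nonneg_left hdec hM0.le]

lemma one_sub_errorProb_mul_log_le (hσw : 0 < σw) (hk : k ≤ ℓ) (s : Scheme ℓ k n) :
    (1 - errorProb P σ σw s) * Real.log (ℓ.choose k) ≤
      n * (condEntropy (s.q : ℝ) (hitProb P σ σw s.γ) k k -
        condEntropy (s.q : ℝ) (hitProb P σ σw s.γ) k 0) + Real.log 2 := by
  classical
  have hp := hitProb_mem_Ioo (P := P) (σ := σ) hσw s.γ_pos
  have hcard : (Finset.powersetCard k (Finset.univ : Finset (Fin ℓ))).card = ℓ.choose k := by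
    simp
  have hM : (0 : ℝ) < ℓ.choose k := by exact_mod_cast Nat.choose_pos hk
  have h := sum_correct_mul_log_le s.q.2.1 s.q.2.2 hp
    (Finset.powersetCard k (Finset.univ : Finset (Fin ℓ)))
    (fun A hA => (Finset.mem_powersetCard.1 hA).2)
    (Finset.powersetCard_nonempty.2 (by simpa))
    (fun y : Fin n → (Fin ℓ → Bool) × Bool => s.detect (toPreambles y) (toOutputs y))
  rw [hcard] at h
  have hsplit : 1 - errorProb P σ σw s = 1 / (ℓ.choose k : ℝ) *
      ∑ A ∈ Finset.powersetCard k (Finset.univ : Finset (Fin ℓ)),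
        ∑ y : Fin n → (Fin ℓ → Bool) × Bool,
          (∏ t, letterWeight (s.q : ℝ) (hitProb P σ σw s.γ) A (y t)) *
            if s.detect (toPreambles y) (toOutputs y) = A then 1 else 0 := by
    have hA : ∀ A : Finset (Fin ℓ), ∑ y : Fin n → (Fin ℓ → Bool) × Bool,
          (∏ t, letterWeight (s.q : ℝ) (hitProb P σ σw s.γ) A (y t)) *
            (if s.detect (toPreambles y) (toOutputs y) = A then (1 : ℝ) else 0) =
        1 - ∑ y : Fin n → (Fin ℓ → Bool) × Bool,
          (∏ t, letterWeight (s.q : ℝ) (hitProb P σ σw s.γ) A (y t)) *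
            (if s.detect (toPreambles y) (toOutputs y) ≠ A then (1 : ℝ) else 0) := by
      intro A
      have h1 : ∑ y : Fin n → (Fin ℓ → Bool) × Bool,
          ∏ t, letterWeight (s.q : ℝ) (hitProb P σ σw s.γ) A (y t) = 1 := by
        rw [sum_prod_eq_pow, sum_letterWeight, one_pow]
      rw [← h1, ← Finset.sum_sub_distrib]
      refine Finset.sum_congr rfl fun y _ => ?_
      split_ifs <;> simp_all
    simp only [hA]
    rw [errorProb_eq_sum hσw, Finset.sum_sub_distrib, Finset.sum_const, hcard, nsmul_eq_mul]
    field_simp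
  rw [hsplit, mul_assoc, one_div, inv_mul_le_iff₀ hM]
  exact h

end Converse

/-! ### The maximal rate: existence and positivity -/

section MaxRate

variable {P σ σw : ℝ≥0} {k : ℕ}

lemma entropy_eq (x : ℝ) : entropy x = Real.binEntropy x / Real.log 2 := by
  rw [entropy, Real.binEntropy_eq_negMulLog_add_negMulLog_one_sub, Real.negMulLog, Real.negMulLog,
    Real.logb, Real.logb]
  ring

/-- The rate is the mutual information between all active symbols and the output. -/
lemma rate_eq (γ : ℝ) (q : unitInterval) :
    rate P σ σw k γ q = (condEntropy (q : ℝ) (hitProb P σ σw γ) k k -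
      condEntropy (q : ℝ) (hitProb P σ σw γ) k 0) / Real.log 2 := by
  rw [rate, integral_binomial_eq_binomialMean, integral_binomial_eq_binomialMean]
  simp only [entropy_eq, div_eq_mul_inv]
  rw [binomialMean_mul_const, condEntropy, condEntropy, Nat.sub_self, Nat.sub_zero, sub_mul]
  simp [binomialMean, condHit]

lemma continuous_binomialMean {X : Type*} [TopologicalSpace X] (m : ℕ) {q : X → ℝ}
    {f : X → ℕ → ℝ} (hq : Continuous q) (hf : ∀ v, Continuous fun x => f x v) :
    Continuous fun x => binomialMean (q x) m (f x) := by
  induction m generalizing f with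
  | zero => exact hf 0
  | succ m ih =>
    exact ((continuous_const.sub hq).mul (ih hf)).add (hq.mul (ih fun v => hf (v + 1)))

lemma continuous_rate :
    Continuous fun x : ℝ × unitInterval => rate P σ σw k x.1 x.2 := by
  have hq : Continuous fun x : ℝ × unitInterval => ((x.2 : unitInterval) : ℝ) := by fun_prop
  have hh : ∀ v, Continuous fun x : ℝ × unitInterval => hitProb P σ σw x.1 v := by
    intro v
    unfold hitProb
    fun_prop
  simp only [rate_eq, condEntropy, condHit]
  refine Continuous.div_const (Continuous.sub ?_ ?_) _
  · exact continuous_binomialMean _ hq fun v => Real.binEntropy_continuous.comp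
      (continuous_binomialMean _ hq fun w => hh _)
  · exact continuous_binomialMean _ hq fun v => Real.binEntropy_continuous.comp
      (continuous_binomialMean _ hq fun w => hh _)

lemma hitProb_mono (hσw : 0 < σw) {γ : ℝ} (hγ : 0 < γ) : Monotone (hitProb P σ σw γ) := by
  intro v w hvw
  have : (0 : ℝ) < σw := hσw
  rw [hitProb, hitProb, Real.exp_le_exp, neg_le_neg_iff]
  gcongr

/-- Dropping the nonnegative conditional entropy leaves a bound that is small whenever the mean hit
probability is near `0` or `1`, which is the case for extreme thresholds. -/
lemma rate_le_binEntropy (hσw : 0 < σw) {γ : ℝ} (hγ : 0 < γ) (q : unitInterval) :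
    rate P σ σw k γ q ≤
      Real.binEntropy (binomialMean (q : ℝ) k (hitProb P σ σw γ)) / Real.log 2 := by
  rw [rate_eq]
  have h2 : 0 < Real.log 2 := Real.log_pos one_lt_two
  have h : 0 ≤ condEntropy (q : ℝ) (hitProb P σ σw γ) k 0 := by
    rw [condEntropy, ← binomialMean_const (q := (q : ℝ)) (k - 0) 0]
    refine binomialMean_mono q.2.1 q.2.2 fun v _ => ?_
    have := hitProb_mem_Ioo (P := P) (σ := σ) hσw hγ v
    exact Real.binEntropy_nonneg this.1.le this.2.le
  have e : condEntropy (q : ℝ) (hitProb P σ σw γ) k k =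
      Real.binEntropy (binomialMean (q : ℝ) k (hitProb P σ σw γ)) := by
    rw [condEntropy, Nat.sub_self]
    simp [binomialMean, condHit]
  rw [e]
  gcongr
  linarith

lemma binomialMean_hitProb_mem_Icc (hσw : 0 < σw) {γ : ℝ} (hγ : 0 < γ) (q : unitInterval) :
    binomialMean (q : ℝ) k (hitProb P σ σw γ) ∈
      Set.Icc (hitProb P σ σw γ 0) (hitProb P σ σw γ k) := by
  constructor
  · rw [← binomialMean_const (q := (q : ℝ)) k (hitProb P σ σw γ 0)]
    exact binomialMean_mono q.2.1 q.2.2 fun v _ => hitProb_mono hσw hγ (Nat.zero_le v)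
  · rw [← binomialMean_const (q := (q : ℝ)) k (hitProb P σ σw γ k)]
    exact binomialMean_mono q.2.1 q.2.2 fun v hv => hitProb_mono hσw hγ hv

/-- The rate vanishes, uniformly in `q`, for small thresholds. -/
lemma exists_rate_lt_of_le (hσw : 0 < σw) {r : ℝ} (hr : 0 < r) :
    ∃ γ₀ > 0, ∀ γ, 0 < γ → γ < γ₀ → ∀ q, rate P σ σw k γ q < r := by
  have h2 : 0 < Real.log 2 := Real.log_pos one_lt_two
  have hc : ∀ᶠ x in 𝓝 (1 : ℝ), Real.binEntropy x < r * Real.log 2 :=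
    Real.binEntropy_continuous.continuousAt.eventually_lt continuousAt_const
      (by rw [Real.binEntropy_one]; positivity)
  obtain ⟨ε, hε, hb⟩ := Metric.eventually_nhds_iff.1 hc
  have hh : Tendsto (fun γ => hitProb P σ σw γ 0) (𝓝 0) (𝓝 1) := by
    have : Continuous fun γ => hitProb P σ σw γ 0 := by unfold hitProb; fun_prop
    simpa [hitProb] using this.tendsto 0
  obtain ⟨δ, hδ, hd⟩ := Metric.eventually_nhds_iff.1
    (hh.eventually (lt_mem_nhds (show 1 - ε < 1 by linarith)))
  refine ⟨δ, hδ, fun γ h0 h1 q => (rate_le_binEntropy hσw h0 q).trans_lt ?_⟩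
  rw [div_lt_iff₀ h2]
  have hm := binomialMean_hitProb_mem_Icc (P := P) (σ := σ) (k := k) hσw h0 q
  have hk := (hitProb_mem_Ioo (P := P) (σ := σ) hσw h0 k).2
  have := hd (show dist γ 0 < δ by rwa [Real.dist_eq, sub_zero, abs_of_pos h0])
  refine hb ?_
  rw [Real.dist_eq, abs_lt]
  constructor <;> linarith [hm.1, hm.2]

/-- The rate vanishes, uniformly in `q`, for large thresholds. -/
lemma exists_rate_lt_of_ge (hσw : 0 < σw) {r : ℝ} (hr : 0 < r) :
    ∃ γ₀, ∀ γ, 0 < γ → γ₀ < γ → ∀ q, rate P σ σw k γ q < r := by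
  have h2 : 0 < Real.log 2 := Real.log_pos one_lt_two
  have hw : (0 : ℝ) < σw := hσw
  have hc : ∀ᶠ x in 𝓝 (0 : ℝ), Real.binEntropy x < r * Real.log 2 :=
    Real.binEntropy_continuous.continuousAt.eventually_lt continuousAt_const
      (by rw [Real.binEntropy_zero]; positivity)
  obtain ⟨ε, hε, hb⟩ := Metric.eventually_nhds_iff.1 hc
  have hh : Tendsto (fun γ => hitProb P σ σw γ k) atTop (𝓝 0) :=
    Real.tendsto_exp_neg_atTop_nhds_zero.comp (tendsto_id.atTop_div_const (by positivity))
  obtain ⟨γ₀, hd⟩ := eventually_atTop.1 (hh.eventually (gt_mem_nhds hε))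
  refine ⟨γ₀, fun γ h0 h1 q => (rate_le_binEntropy hσw h0 q).trans_lt ?_⟩
  rw [div_lt_iff₀ h2]
  have hm := binomialMean_hitProb_mem_Icc (P := P) (σ := σ) (k := k) hσw h0 q
  have hk := (hitProb_mem_Ioo (P := P) (σ := σ) hσw h0 0).1
  have := hd γ h1.le
  refine hb ?_
  rw [Real.dist_eq, abs_lt]
  constructor <;> linarith [hm.1, hm.2]

/-- Strict Jensen for the entropy: with `0 < q < 1` all binomial weights are positive, and the hit
probabilities for `v = 0` and `v = 1` differ. Since `1 ≤ k`, both values occur. -/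
lemma rate_pos (hP : 0 < P) (hσ : 0 < σ) (hσw : 0 < σw) (hk : 1 ≤ k) {γ : ℝ} (hγ : 0 < γ)
    {q : unitInterval} (h0 : 0 < (q : ℝ)) (h1 : (q : ℝ) < 1) : 0 < rate P σ σw k γ q := by
  have hw : (0 : ℝ) < σw := hσw
  have hs : (0 : ℝ) < σ := hσ
  have hp' : (0 : ℝ) < P := hP
  have h1' : 0 < 1 - (q : ℝ) := sub_pos.2 h1
  rw [rate_eq]
  refine div_pos ?_ (Real.log_pos one_lt_two)
  have hp := hitProb_mem_Ioo (P := P) (σ := σ) hσw hγ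
  have hone := binomialMean_eq_sum (q := (q : ℝ)) k fun _ => 1
  rw [binomialMean_const] at hone
  have hJ := (Real.strictConcave_binEntropy.lt_map_sum_iff_of_pos (t := Finset.range (k + 1))
    (w := fun j => k.choose j * ((q : ℝ) ^ j * (1 - q) ^ (k - j)))
    (p := hitProb P σ σw γ)
    (fun j hj => by
      have : 0 < k.choose j := Nat.choose_pos (Nat.lt_succ_iff.1 (Finset.mem_range.1 hj))
      positivity)
    (by simpa only [mul_one] using hone.symm)
    (fun j _ => Set.Ioo_subset_Icc_self (hp j))).2 ⟨0, by simp, 1, Finset.mem_range.2 (by omega), by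
      refine ne_of_lt ?_
      rw [hitProb, hitProb, Real.exp_lt_exp, neg_lt_neg_iff]
      refine div_lt_div_of_pos_left hγ (by positivity) ?_
      have : 0 < (σ : ℝ) ^ 2 * P := by positivity
      push_cast
      linarith⟩
  rw [condEntropy, condEntropy, Nat.sub_self, Nat.sub_zero]
  simp only [binomialMean, condHit, Nat.zero_add, Nat.add_zero]
  rw [binomialMean_eq_sum, binomialMean_eq_sum]
  simpa only [smul_eq_mul, mul_assoc, sub_pos] using hJ

/-- The positive rate at `γ = 1`, `q = 1 / 2` serves as a reference. Thresholds outside some `[γ₁,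
γ₂]` with `γ₁ > 0` do worse for every `q`, and on the compact remainder the continuous rate attains
its maximum. -/
lemma isGreatest_maxRate (hP : 0 < P) (hσ : 0 < σ) (hσw : 0 < σw) (hk : 1 ≤ k) :
    IsGreatest (rates P σ σw k) (maxRate P σ σw k) ∧ 0 < maxRate P σ σw k := by
  obtain ⟨q₀, hq0, hq1⟩ : ∃ q₀ : unitInterval, 0 < (q₀ : ℝ) ∧ (q₀ : ℝ) < 1 :=
    ⟨⟨1 / 2, by norm_num, by norm_num⟩, by norm_num, by norm_num⟩
  obtain ⟨r₀, hr⟩ : ∃ r, r = rate P σ σw k 1 q₀ := ⟨_, rfl⟩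
  have hr₀ : 0 < r₀ := hr ▸ rate_pos hP hσ hσw hk one_pos hq0 hq1
  obtain ⟨γ₁, hγ₁, hsmall⟩ := exists_rate_lt_of_le (P := P) (σ := σ) (k := k) hσw hr₀
  obtain ⟨γ₂, hlarge⟩ := exists_rate_lt_of_ge (P := P) (σ := σ) (k := k) hσw hr₀
  have hmem : ((1 : ℝ), q₀) ∈ Set.Icc γ₁ γ₂ ×ˢ (Set.univ : Set unitInterval) := by
    refine ⟨⟨?_, ?_⟩, trivial⟩
    · by_contra! h
      exact (hsmall 1 one_pos h q₀).ne' hr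
    · by_contra! h
      exact (hlarge 1 one_pos h q₀).ne' hr
  obtain ⟨x, hx, hmax⟩ := (isCompact_Icc.prod isCompact_univ).exists_isMaxOn ⟨_, hmem⟩
    (continuous_rate (P := P) (σ := σ) (σw := σw) (k := k)).continuousOn
  rw [isMaxOn_iff] at hmax
  obtain ⟨γ, q⟩ := x
  have hγ : 0 < γ := hγ₁.trans_le (Set.mem_prod.1 hx).1.1
  have hr₀le : r₀ ≤ rate P σ σw k γ q := hr.trans_le (hmax (1, q₀) hmem)
  have hg : IsGreatest (rates P σ σw k) (rate P σ σw k γ q) := by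
    refine ⟨⟨γ, hγ, q, rfl⟩, ?_⟩
    rintro _ ⟨γ', hγ', q', rfl⟩
    by_cases h1 : γ' < γ₁
    · exact (hsmall γ' hγ' h1 q').le.trans hr₀le
    by_cases h2 : γ₂ < γ'
    · exact (hlarge γ' hγ' h2 q').le.trans hr₀le
    · have : (γ', q') ∈ Set.Icc γ₁ γ₂ ×ˢ (Set.univ : Set unitInterval) :=
        ⟨⟨not_lt.1 h1, not_lt.1 h2⟩, trivial⟩
      exact hmax (γ', q') this
  have e : maxRate P σ σw k = rate P σ σw k γ q := hg.csSup_eq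
  rw [e]
  exact ⟨hg, hr₀.trans_le hr₀le⟩

end MaxRate

/-! ### Achievability: threshold decoding and the random coding bound -/

section Achievability

variable {q : ℝ} {p : ℕ → ℝ}

/-- A Chernoff bound for the lower tail of the information density, uniform in the number of
users. -/
lemma exists_sum_letterWeight_mul_exp_le {k i : ℕ} (hi : i ≤ k) {η : ℝ} (hη : 0 < η) :
    ∃ r : ℝ, 0 < r ∧ ∀ (ℓ : ℕ) (A S : Finset (Fin ℓ)), S ⊆ A → A.card = k → (A \ S).card = i →
      ∑ a, letterWeight q p A a * Real.exp (-(r * letterInfo q p A S a)) ≤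
        Real.exp (-(r * (condEntropy q p k i - condEntropy q p k 0 - η))) := by
  set c : ℕ → ℕ → Bool → ℝ := fun u v z =>
    Real.log (bitWeight (p (u + v)) z) - Real.log (bitWeight (condHit q p i u) z) with hc
  -- The moment generating function of the negated density, written through binomial counts alone.
  -- Hence it does not depend on `ℓ`, `A` or `S`, and one `r` serves them all.
  set g : ℝ → ℝ := fun r => binomialMean q (k - i) fun u => binomialMean q i fun v =>
    ∑ z, bitWeight (p (u + v)) z * Real.exp (-(r * c u v z)) with hg
  have hg0 : g 0 = 1 := by
    simp only [hg, zero_mul, neg_zero, Real.exp_zero, mul_one, sum_bool_weight, binomialMean_const]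
  have hderiv : HasDerivAt g (-(condEntropy q p k i - condEntropy q p k 0)) 0 := by
    have h1 : HasDerivAt g (binomialMean q (k - i) fun u => binomialMean q i fun v =>
        ∑ z, bitWeight (p (u + v)) z * (-1 * c u v z)) 0 := by
      refine hasDerivAt_binomialMean _ fun u => hasDerivAt_binomialMean _ fun v => ?_
      refine HasDerivAt.fun_sum fun z _ => HasDerivAt.const_mul _ ?_
      have := ((hasDerivAt_id (0 : ℝ)).mul_const (c u v z)).neg.exp
      simpa using this
    convert h1 using 1
    have h2 := binomialMean_log_sub (q := q) (p := p) (k - i) i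
    rw [Nat.sub_add_cancel hi] at h2
    rw [← h2, ← neg_one_mul, ← binomialMean_const_mul]
    congr 1
    funext u
    rw [← binomialMean_const_mul]
    congr 1
    funext v
    rw [Finset.mul_sum]
    exact Finset.sum_congr rfl fun z _ => by rw [hc]; ring
  -- As `g 0 = 1` and `g'(0)` is minus the information, `g r ≤ 1 - r (I_i - η)` for small `r > 0`.
  -- Then `1 + x ≤ exp x` gives the bound.
  obtain ⟨δ, hδ, hb⟩ := Metric.eventually_nhds_iff.1
    ((hasDerivAt_iff_isLittleO.1 hderiv).def hη)
  have hr : (0 : ℝ) < δ / 2 := by positivity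
  refine ⟨δ / 2, hr, fun ℓ A S hS hA hAS => ?_⟩
  have hsum : ∑ a, letterWeight q p A a * Real.exp (-(δ / 2 * letterInfo q p A S a)) =
      g (δ / 2) := by
    simp only [letterInfo_eq hS, hAS]
    rw [sum_letterWeight_mul hS fun u v z => Real.exp (-(δ / 2 * c u v z)), hAS]
    have : S.card = k - i := by
      have := Finset.card_sdiff_add_card_eq_card hS
      omega
    rw [this]
  have h3 := hb (show dist (δ / 2) 0 < δ by
    rw [Real.dist_eq, sub_zero, abs_of_pos hr]; linarith)
  rw [hsum]
  rw [hg0, sub_zero, Real.norm_eq_abs, Real.norm_eq_abs, abs_of_pos hr, smul_eq_mul] at h3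
  have h4 := (le_abs_self _).trans h3
  refine le_trans ?_ (Real.add_one_le_exp _)
  linarith

/-- For a wrong set `A'` of users, the likelihood ratio has mean one. -/
lemma sum_letterWeight_mul_exp_letterInfo {ι : Type*} [Fintype ι] [DecidableEq ι]
    (h0 : 0 ≤ q) (h1 : q ≤ 1) (hp : ∀ v, p v ∈ Set.Ioo (0 : ℝ) 1)
    {A A' : Finset ι} (hcard : A.card = A'.card) :
    ∑ a, letterWeight q p A a * Real.exp (letterInfo q p A' (A ∩ A') a) = 1 := by
  have hA' : A' \ (A ∩ A') = A' \ A := by simp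
  set i := (A' \ A).card with hi
  have hAA : (A \ A').card = i := (Finset.card_sdiff_comm hcard)
  have hG := fun u => condHit_mem_Ioo h0 h1 hp i u
  have hx : ∀ a : (ι → Bool) × Bool,
      letterWeight q p A a * Real.exp (letterInfo q p A' (A ∩ A') a) =
      symbolWeight q a.1 *
        (bitWeight (p (onCount (A ∩ A') a.1 + onCount (A \ A') a.1)) a.2 *
        bitWeight (p (onCount (A ∩ A') a.1 + onCount (A' \ A) a.1)) a.2 /
        bitWeight (condHit q p i (onCount (A ∩ A') a.1)) a.2) := by
    intro a
    have e : onCount A a.1 = onCount (A ∩ A') a.1 + onCount (A \ A') a.1 := by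
      rw [← onCount_union (Finset.disjoint_sdiff_inter A A').symm, Finset.union_comm,
        Finset.sdiff_union_inter]
    rw [letterInfo_eq Finset.inter_subset_right, hA', ← hi, letterWeight, e, Real.exp_sub,
      Real.exp_log (bitWeight_pos (hp _) _), Real.exp_log (bitWeight_pos (hG _) _)]
    ring
  simp only [hx]
  rw [Fintype.sum_prod_type]
  simp only [← Finset.mul_sum]
  rw [sum_symbolWeight_onCount_three (S := A ∩ A') (T := A \ A') (U := A' \ A)
    (Finset.disjoint_sdiff_inter A A').symm
    (by rw [Finset.inter_comm]; exact (Finset.disjoint_sdiff_inter A' A).symm)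
    (Finset.disjoint_of_subset_right Finset.sdiff_subset Finset.sdiff_disjoint)
    (fun u v w => ∑ z, bitWeight (p (u + v)) z * bitWeight (p (u + w)) z /
      bitWeight (condHit q p i u) z), hAA, ← hi]
  -- Given the symbols in `A ∩ A'`, those of `A' \ A` are independent of the output. Averaging over
  -- the two differences separately gives two factors `condHit`, and the denominator cancels one of
  -- them.
  have hmean : ∀ u z, (binomialMean q i fun v => bitWeight (p (u + v)) z) =
      bitWeight (condHit q p i u) z := by
    intro u z
    cases z
    · simp only [bitWeight, Bool.false_eq_true, if_false]
      rw [binomialMean_sub, binomialMean_const, condHit]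
    · simp only [bitWeight, if_true]
      rw [condHit]
  have hinner : ∀ u, (binomialMean q i fun v => binomialMean q i fun w =>
      ∑ z, bitWeight (p (u + v)) z * bitWeight (p (u + w)) z /
        bitWeight (condHit q p i u) z) = 1 := by
    intro u
    rw [← sum_bool_weight (condHit q p i u)]
    simp only [Fintype.sum_bool, binomialMean_add, binomialMean_const_mul,
      binomialMean_mul_const, div_eq_mul_inv, hmean]
    rw [mul_inv_cancel_right₀ (bitWeight_pos (hG u) _).ne',
      mul_inv_cancel_right₀ (bitWeight_pos (hG u) _).ne']
  simp only [hinner, binomialMean_const]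

/-- A threshold decoder for the information densities: it errs only if a density of the active set
is small, or a density of a wrong set is large. -/
lemma exists_detect (q : ℝ) (p : ℕ → ℝ) (ℓ k n : ℕ) (τ : ℕ → ℝ) :
    ∃ d : Preambles ℓ n → (Fin n → Bool) → Finset (Fin ℓ),
      (k ≤ ℓ → ∀ X z, (d X z).card = k) ∧
      ∀ (y : Fin n → (Fin ℓ → Bool) × Bool) (A : Finset (Fin ℓ)), A.card = k →
        d (toPreambles y) (toOutputs y) ≠ A →
        (∃ S ∈ A.ssubsets, ∑ t, letterInfo q p A S (y t) < τ (A \ S).card) ∨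
        ∃ A' ∈ (Finset.powersetCard k (Finset.univ : Finset (Fin ℓ))).erase A,
          τ (A' \ A).card ≤ ∑ t, letterInfo q p A' (A ∩ A') (y t) := by
  classical
  set ok : Finset (Fin ℓ) → (Fin n → (Fin ℓ → Bool) × Bool) → Prop := fun A y =>
    ∀ S ∈ A.ssubsets, τ (A \ S).card ≤ ∑ t, letterInfo q p A S (y t) with hok
  -- The decoder picks any `k`-set passing all its tests, with no uniqueness demanded, and otherwise
  -- an arbitrary `k`-set if there is one.
  have hex : ∀ y, ∃ D : Finset (Fin ℓ), (k ≤ ℓ → D.card = k) ∧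
      ((∃ A, A.card = k ∧ ok A y) → D.card = k ∧ ok D y) := by
    intro y
    by_cases h : ∃ A, A.card = k ∧ ok A y
    · obtain ⟨A, hA⟩ := h
      exact ⟨A, fun _ => hA.1, fun _ => hA⟩
    · by_cases hk : k ≤ ℓ
      · obtain ⟨D, -, hD⟩ := Finset.exists_subset_card_eq
          (s := (Finset.univ : Finset (Fin ℓ))) (n := k) (by simpa)
        exact ⟨D, fun _ => hD, fun h' => absurd h' h⟩
      · exact ⟨∅, fun h' => absurd h' hk, fun h' => absurd h' h⟩
  choose D hD hD' using hex
  refine ⟨fun X z => D fun t => (fun i => X i t, z t), fun hk X z => hD _ hk, ?_⟩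
  intro y A hA hne
  have hne' : D y ≠ A := hne
  by_cases hA' : ok A y
  · right
    obtain ⟨hc, ho⟩ := hD' y ⟨A, hA, hA'⟩
    refine ⟨D y, Finset.mem_erase.2 ⟨hne', Finset.mem_powersetCard.2 ⟨Finset.subset_univ _, hc⟩⟩,
      ?_⟩
    -- A wrong set chosen by the decoder has passed the test given its intersection with `A`, a
    -- proper subset because the cardinalities agree.
    have hss : A ∩ D y ∈ (D y).ssubsets := by
      rw [Finset.mem_ssubsets, Finset.ssubset_iff_subset_ne]
      refine ⟨Finset.inter_subset_right, fun h => hne' ?_⟩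
      exact Finset.eq_of_subset_of_card_le (Finset.inter_eq_right.1 h) (by rw [hA, hc])
    have := ho _ hss
    rwa [Finset.sdiff_inter_self_right] at this
  · left
    simp only [hok, not_forall, not_le] at hA'
    obtain ⟨S, hS, h⟩ := hA'
    exact ⟨S, hS, h⟩

/-- Wrong sets of users, grouped by their intersection with the active set. -/
lemma sum_erase_le_sum_ssubsets {ℓ k : ℕ} {A : Finset (Fin ℓ)} (hA : A.card = k) {f : ℕ → ℝ}
    (hf : ∀ i, 0 ≤ f i) :
    ∑ A' ∈ (Finset.powersetCard k (Finset.univ : Finset (Fin ℓ))).erase A, f (A' \ A).card ≤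
      ∑ S ∈ A.ssubsets, (ℓ : ℝ) ^ (A \ S).card * f (A \ S).card := by
  have hmap : ∀ A' ∈ (Finset.powersetCard k (Finset.univ : Finset (Fin ℓ))).erase A,
      A ∩ A' ∈ A.ssubsets := by
    intro A' hA'
    obtain ⟨hne, hc⟩ := Finset.mem_erase.1 hA'
    have hc := (Finset.mem_powersetCard.1 hc).2
    rw [Finset.mem_ssubsets, Finset.ssubset_iff_subset_ne]
    refine ⟨Finset.inter_subset_left, fun h => hne ?_⟩
    exact (Finset.eq_of_subset_of_card_le (Finset.inter_eq_left.1 h) (by rw [hA, hc])).symm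
  rw [← Finset.sum_fiberwise_of_maps_to hmap]
  refine Finset.sum_le_sum fun S hS => ?_
  have hcard : ∀ A' ∈ ((Finset.powersetCard k (Finset.univ : Finset (Fin ℓ))).erase A).filter
      (fun A' => A ∩ A' = S), (A' \ A).card = (A \ S).card := by
    intro A' hA'
    obtain ⟨hmem, rfl⟩ := Finset.mem_filter.1 hA'
    have hc := (Finset.mem_powersetCard.1 (Finset.mem_of_mem_erase hmem)).2
    rw [Finset.sdiff_inter_self_left]
    exact (Finset.card_sdiff_comm (by rw [hA, hc])).symm
  rw [Finset.sum_congr rfl fun A' hA' => by rw [hcard A' hA'], Finset.sum_const, nsmul_eq_mul]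
  refine mul_le_mul_of_nonneg_right ?_ (hf _)
  -- Once `A ∩ A' = S` is fixed, `A'` is determined by `A' \ A`, and there are at most `ℓ ^ i` sets
  -- of that size `i`.
  have h1 : (((Finset.powersetCard k (Finset.univ : Finset (Fin ℓ))).erase A).filter
      (fun A' => A ∩ A' = S)).card ≤
      (Finset.powersetCard (A \ S).card (Finset.univ : Finset (Fin ℓ))).card := by
    refine Finset.card_le_card_of_injOn (fun A' => A' \ A) (fun A' hA' => ?_) ?_
    · exact Finset.mem_powersetCard.2 ⟨Finset.subset_univ _, hcard A' hA'⟩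
    · intro A₁ h₁ A₂ h₂ h
      have e₁ := (Finset.mem_filter.1 h₁).2
      have e₂ := (Finset.mem_filter.1 h₂).2
      have h' : A₁ \ A = A₂ \ A := h
      rw [← Finset.sdiff_union_inter A₁ A, ← Finset.sdiff_union_inter A₂ A, h',
        Finset.inter_comm A₁, Finset.inter_comm A₂, e₁, e₂]
  rw [Finset.card_powersetCard, Finset.card_univ, Fintype.card_fin] at h1
  exact_mod_cast h1.trans (Nat.choose_le_pow _ _)

/-- A random coding bound for the threshold decoder. -/
lemma exists_scheme_errorProb_le {P σ σw : ℝ≥0} (hσw : 0 < σw) {γ : ℝ} (hγ : 0 < γ)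
    (q : unitInterval) (ℓ k n : ℕ) (τ r m : ℕ → ℝ)
    (hr : ∀ i ∈ Finset.Icc 1 k, 0 < r i)
    (hm : ∀ i ∈ Finset.Icc 1 k, ∀ A S : Finset (Fin ℓ), S ⊆ A → A.card = k → (A \ S).card = i →
      ∑ a, letterWeight (q : ℝ) (hitProb P σ σw γ) A a *
        Real.exp (-(r i * letterInfo (q : ℝ) (hitProb P σ σw γ) A S a)) ≤ m i)
    (hm0 : ∀ i, 0 ≤ m i) :
    ∃ s : Scheme ℓ k n, errorProb P σ σw s ≤
      2 ^ k * ∑ i ∈ Finset.Icc 1 k,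
        (Real.exp (r i * τ i) * m i ^ n + (ℓ : ℝ) ^ i * Real.exp (-τ i)) := by
  set p := hitProb P σ σw γ with hpdef
  have hp : ∀ v, p v ∈ Set.Ioo (0 : ℝ) 1 := hitProb_mem_Ioo hσw hγ
  obtain ⟨d, hd, herr⟩ := exists_detect (q : ℝ) p ℓ k n τ
  set s : Scheme ℓ k n := ⟨q, γ, hγ, d, hd⟩ with hs
  refine ⟨s, ?_⟩
  set b : ℕ → ℝ := fun i => Real.exp (r i * τ i) * m i ^ n + (ℓ : ℝ) ^ i * Real.exp (-τ i) with hb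
  have hb0 : ∀ i, 0 ≤ b i := fun i => by have := hm0 i; positivity
  have hA : ∀ A ∈ Finset.powersetCard k (Finset.univ : Finset (Fin ℓ)),
      ∑ y : Fin n → (Fin ℓ → Bool) × Bool, (∏ t, letterWeight (q : ℝ) p A (y t)) *
        (if d (toPreambles y) (toOutputs y) ≠ A then 1 else 0) ≤
      2 ^ k * ∑ i ∈ Finset.Icc 1 k, b i := by
    intro A hA
    have hc := (Finset.mem_powersetCard.1 hA).2
    have hss : ∀ S ∈ A.ssubsets, (A \ S).card ∈ Finset.Icc 1 k := by
      intro S hS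
      have hS := Finset.mem_ssubsets.1 hS
      rw [Finset.mem_Icc]
      refine ⟨?_, hc ▸ Finset.card_le_card Finset.sdiff_subset⟩
      exact Finset.card_pos.2 (Finset.sdiff_nonempty.2 hS.2)
    -- Union bound with Markov's inequality, pointwise: each failing test is replaced by an
    -- exponential that is at least one when it fails. Summed over words, every term becomes an
    -- `n`-th power.
    have hy : ∀ y : Fin n → (Fin ℓ → Bool) × Bool,
        (∏ t, letterWeight (q : ℝ) p A (y t)) *
          (if d (toPreambles y) (toOutputs y) ≠ A then 1 else 0) ≤
        (∑ S ∈ A.ssubsets, Real.exp (r (A \ S).card * τ (A \ S).card) *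
          ∏ t, (letterWeight (q : ℝ) p A (y t) *
            Real.exp (-(r (A \ S).card * letterInfo (q : ℝ) p A S (y t))))) +
        ∑ A' ∈ (Finset.powersetCard k (Finset.univ : Finset (Fin ℓ))).erase A,
          Real.exp (-τ (A' \ A).card) *
            ∏ t, (letterWeight (q : ℝ) p A (y t) *
              Real.exp (letterInfo (q : ℝ) p A' (A ∩ A') (y t))) := by
      intro y
      have hw0 : ∀ t, 0 ≤ letterWeight (q : ℝ) p A (y t) := fun t =>
        letterWeight_nonneg q.2.1 q.2.2 hp _ _
      have hW0 : 0 ≤ ∏ t, letterWeight (q : ℝ) p A (y t) := Finset.prod_nonneg fun t _ => hw0 t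
      have n1 : ∀ S ∈ A.ssubsets, 0 ≤ Real.exp (r (A \ S).card * τ (A \ S).card) *
          ∏ t, (letterWeight (q : ℝ) p A (y t) *
            Real.exp (-(r (A \ S).card * letterInfo (q : ℝ) p A S (y t)))) := fun S _ =>
        mul_nonneg (Real.exp_pos _).le
          (Finset.prod_nonneg fun t _ => mul_nonneg (hw0 t) (Real.exp_pos _).le)
      have n2 : ∀ A' ∈ (Finset.powersetCard k (Finset.univ : Finset (Fin ℓ))).erase A,
          0 ≤ Real.exp (-τ (A' \ A).card) * ∏ t, (letterWeight (q : ℝ) p A (y t) *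
              Real.exp (letterInfo (q : ℝ) p A' (A ∩ A') (y t))) := fun A' _ =>
        mul_nonneg (Real.exp_pos _).le
          (Finset.prod_nonneg fun t _ => mul_nonneg (hw0 t) (Real.exp_pos _).le)
      split_ifs with h
      · rw [mul_one]
        rcases herr y A hc h with ⟨S, hS, hlt⟩ | ⟨A', hA', hle⟩
        · refine le_trans ?_ (le_add_of_nonneg_right (Finset.sum_nonneg n2))
          refine le_trans ?_ (Finset.single_le_sum n1 hS)
          rw [Finset.prod_mul_distrib, ← Real.exp_sum, mul_left_comm, ← Real.exp_add,
            Finset.sum_neg_distrib, ← Finset.mul_sum, ← sub_eq_add_neg, ← mul_sub]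
          refine le_mul_of_one_le_right hW0 (Real.one_le_exp ?_)
          exact mul_nonneg (hr _ (hss S hS)).le (by linarith)
        · refine le_trans ?_ (le_add_of_nonneg_left (Finset.sum_nonneg n1))
          refine le_trans ?_ (Finset.single_le_sum n2 hA')
          rw [Finset.prod_mul_distrib, ← Real.exp_sum, mul_left_comm, ← Real.exp_add]
          exact le_mul_of_one_le_right hW0 (Real.one_le_exp (by linarith))
      · rw [mul_zero]
        exact add_nonneg (Finset.sum_nonneg n1) (Finset.sum_nonneg n2)
    calc _ ≤ _ := Finset.sum_le_sum fun y _ => hy y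
      _ = (∑ S ∈ A.ssubsets, Real.exp (r (A \ S).card * τ (A \ S).card) *
            (∑ a, letterWeight (q : ℝ) p A a *
              Real.exp (-(r (A \ S).card * letterInfo (q : ℝ) p A S a))) ^ n) +
          ∑ A' ∈ (Finset.powersetCard k (Finset.univ : Finset (Fin ℓ))).erase A,
            Real.exp (-τ (A' \ A).card) * (∑ a, letterWeight (q : ℝ) p A a *
              Real.exp (letterInfo (q : ℝ) p A' (A ∩ A') a)) ^ n := by
          rw [Finset.sum_add_distrib, Finset.sum_comm, Finset.sum_comm (t := Finset.erase _ _)]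
          simp only [← Finset.mul_sum]
          congr 1
          · refine Finset.sum_congr rfl fun S _ => ?_
            rw [sum_prod_eq_pow fun a => letterWeight (q : ℝ) p A a *
              Real.exp (-(r (A \ S).card * letterInfo (q : ℝ) p A S a))]
          · refine Finset.sum_congr rfl fun A' _ => ?_
            rw [sum_prod_eq_pow fun a => letterWeight (q : ℝ) p A a *
              Real.exp (letterInfo (q : ℝ) p A' (A ∩ A') a)]
      _ ≤ (∑ S ∈ A.ssubsets, Real.exp (r (A \ S).card * τ (A \ S).card) * m (A \ S).card ^ n) +
          ∑ S ∈ A.ssubsets, (ℓ : ℝ) ^ (A \ S).card * Real.exp (-τ (A \ S).card) := by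
          refine add_le_add (Finset.sum_le_sum fun S hS => ?_) ?_
          · refine mul_le_mul_of_nonneg_left (pow_le_pow_left₀ ?_ ?_ n) (Real.exp_pos _).le
            · exact Finset.sum_nonneg fun a _ => mul_nonneg
                (letterWeight_nonneg q.2.1 q.2.2 hp _ _) (Real.exp_pos _).le
            · exact hm _ (hss S hS) A S (Finset.mem_ssubsets.1 hS).1 hc rfl
          · refine le_trans (le_of_eq ?_) (sum_erase_le_sum_ssubsets hc
              (f := fun i => Real.exp (-τ i)) fun i => (Real.exp_pos _).le)
            refine Finset.sum_congr rfl fun A' hA' => ?_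
            have hc' := (Finset.mem_powersetCard.1 (Finset.mem_of_mem_erase hA')).2
            rw [sum_letterWeight_mul_exp_letterInfo q.2.1 q.2.2 hp (by rw [hc, hc']), one_pow,
              mul_one]
      _ = ∑ S ∈ A.ssubsets, b (A \ S).card := by rw [← Finset.sum_add_distrib]
      _ ≤ ∑ S ∈ A.ssubsets, ∑ i ∈ Finset.Icc 1 k, b i := Finset.sum_le_sum fun S hS =>
          Finset.single_le_sum (fun i _ => hb0 i) (hss S hS)
      _ = A.ssubsets.card * ∑ i ∈ Finset.Icc 1 k, b i := by
          rw [Finset.sum_const, nsmul_eq_mul]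
      _ ≤ _ := by
          refine mul_le_mul_of_nonneg_right ?_ (Finset.sum_nonneg fun i _ => hb0 i)
          have : A.ssubsets.card ≤ 2 ^ k := by
            rw [← hc, ← Finset.card_powerset]
            exact Finset.card_le_card (Finset.erase_subset _ _)
          exact_mod_cast this
  rw [errorProb_eq_sum hσw]
  have hsum := Finset.sum_le_sum hA
  rw [Finset.sum_const, Finset.card_powersetCard, Finset.card_univ, Fintype.card_fin,
    nsmul_eq_mul] at hsum
  refine (mul_le_mul_of_nonneg_left hsum (by positivity)).trans ?_
  rw [← mul_assoc]
  -- The averaging factor is only bounded by one, since `ℓ.choose k` vanishes for `ℓ < k`.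
  refine mul_le_of_le_one_left ?_ ?_
  · exact mul_nonneg (by positivity) (Finset.sum_nonneg fun i _ => hb0 i)
  · rw [one_div]
    exact inv_mul_le_one

end Achievability

/-- From `ℓ.choose k ≥ (ℓ + 1 - k) ^ k / k!`, with `ℓ + 1 - k ≥ ℓ / k` and `k! ≤ k ^ k`. For fixed
`k` the loss is a constant. -/
lemma sub_le_log_choose {k ℓ : ℕ} (hk : 1 ≤ k) (hkℓ : k ≤ ℓ) :
    k * Real.log ℓ - 2 * (k * Real.log k) ≤ Real.log (ℓ.choose k) := by
  have hk0 : (0 : ℝ) < k := by exact_mod_cast hk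
  have hℓ0 : (0 : ℝ) < ℓ := by exact_mod_cast hk.trans hkℓ
  have h1 : (ℓ : ℝ) / k ≤ ((ℓ + 1 - k : ℕ) : ℝ) := by
    rw [div_le_iff₀ hk0]
    obtain ⟨d, rfl⟩ := Nat.exists_eq_add_of_le hkℓ
    rw [show k + d + 1 - k = d + 1 by omega]
    have : (1 : ℝ) ≤ k := by exact_mod_cast hk
    push_cast
    nlinarith [Nat.cast_nonneg (α := ℝ) d]
  have h2 : (k.factorial : ℝ) ≤ (k : ℝ) ^ k := by exact_mod_cast Nat.factorial_le_pow k
  have h3 : ((ℓ : ℝ) / k) ^ k / (k : ℝ) ^ k ≤ ℓ.choose k := by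
    refine le_trans ?_ (Nat.pow_le_choose (α := ℝ) k ℓ)
    gcongr
  have h4 := Real.log_le_log (by positivity) h3
  rw [Real.log_div (by positivity) (by positivity), Real.log_pow, Real.log_pow,
    Real.log_div hℓ0.ne' hk0.ne'] at h4
  linarith

/-! ### Asymptotics for a constant number of active users -/

section Cost

variable {P σ σw : ℝ≥0}

lemma condEntropy_sub_le_maxRate (hP : 0 < P) (hσ : 0 < σ) (hσw : 0 < σw) {k : ℕ} (hk : 1 ≤ k)
    {γ : ℝ} (hγ : 0 < γ) (q : unitInterval) :
    condEntropy (q : ℝ) (hitProb P σ σw γ) k k - condEntropy (q : ℝ) (hitProb P σ σw γ) k 0 ≤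
      maxRate P σ σw k * Real.log 2 := by
  have h := (isGreatest_maxRate hP hσ hσw hk).1.2 ⟨γ, hγ, q, rfl⟩
  rwa [rate_eq, div_le_iff₀ (Real.log_pos one_lt_two)] at h

/-- A placeholder for the value `k = 0`, where no scheme of small error is provided but one must
still be chosen. The threshold decoder is reused only for the size of its output. -/
lemma nonempty_scheme (ℓ k n : ℕ) : Nonempty (Scheme ℓ k n) := by
  obtain ⟨d, hd, -⟩ := exists_detect 0 (fun _ => 0) ℓ k n fun _ => 0
  exact ⟨⟨0, 1, one_pos, d, hd⟩⟩

lemma errorProb_nonneg {ℓ k n : ℕ} (s : Scheme ℓ k n) : 0 ≤ errorProb P σ σw s :=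
  mul_nonneg (by positivity) (Finset.sum_nonneg fun _ _ => measureReal_nonneg)

/-- Achievability for a constant number `k` of active users. -/
lemma exists_schemes_tendsto (hP : 0 < P) (hσ : 0 < σ) (hσw : 0 < σw) {k : ℕ} (hk : 1 ≤ k)
    {ε : ℝ} (hε : 0 < ε) (hε1 : ε < 1) :
    ∃ s : ∀ ℓ : ℕ, Scheme ℓ k ⌈(1 + ε) * (k * Real.logb 2 ℓ / maxRate P σ σw k)⌉₊,
      Tendsto (fun ℓ => errorProb P σ σw (s ℓ)) atTop (𝓝 0) := by
  obtain ⟨⟨⟨γ, hγ, q, hrate⟩, -⟩, hC⟩ := isGreatest_maxRate (k := k) hP hσ hσw hk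
  have hl2 : 0 < Real.log 2 := Real.log_pos one_lt_two
  have hk0 : (0 : ℝ) < k := by exact_mod_cast hk
  set p := hitProb P σ σw γ with hpdef
  have hp : ∀ v, p v ∈ Set.Ioo (0 : ℝ) 1 := hitProb_mem_Ioo hσw hγ
  set I : ℕ → ℝ := fun i => condEntropy (q : ℝ) p k i - condEntropy (q : ℝ) p k 0 with hI
  have hIk : I k = maxRate P σ σw k * Real.log 2 := by
    rw [hrate, rate_eq, div_mul_cancel₀ _ hl2.ne']
  have hIk0 : 0 < I k := by rw [hIk]; positivity
  have hchain : ∀ i ∈ Finset.Icc 1 k, i * I k ≤ k * I i := fun i hi =>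
    condEntropy_sub_ge q.2.1 q.2.2 hp (Finset.mem_Icc.1 hi).2
  -- Chosen so that `I i - η ≥ (I k / k) (i - ε / 4)`.
  set η := ε * I k / (4 * k) with hη
  have hη0 : 0 < η := by positivity
  have hex : ∀ i, ∃ r : ℝ, 0 < r ∧ (i ∈ Finset.Icc 1 k →
      ∀ (ℓ : ℕ) (A S : Finset (Fin ℓ)), S ⊆ A → A.card = k → (A \ S).card = i →
      ∑ a, letterWeight (q : ℝ) p A a * Real.exp (-(r * letterInfo (q : ℝ) p A S a)) ≤
        Real.exp (-(r * (I i - η)))) := by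
    intro i
    by_cases hi : i ∈ Finset.Icc 1 k
    · obtain ⟨r, hr, h⟩ := exists_sum_letterWeight_mul_exp_le (q := (q : ℝ)) (p := p)
        (Finset.mem_Icc.1 hi).2 hη0
      exact ⟨r, hr, fun _ => h⟩
    · exact ⟨1, one_pos, fun h => absurd h hi⟩
  choose r hr hm using hex
  set n : ℕ → ℕ := fun ℓ => ⌈(1 + ε) * (k * Real.logb 2 ℓ / maxRate P σ σw k)⌉₊ with hn
  have hsch := fun ℓ => exists_scheme_errorProb_le (P := P) (σ := σ) hσw hγ q ℓ k (n ℓ)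
    -- The excess `ε / 4` over `i` leaves `ℓ ^ (-ε / 4)` after the union over `ℓ ^ i` wrong sets.
    (fun i => (i + ε / 4) * Real.log ℓ) r (fun i => Real.exp (-(r i * (I i - η))))
    (fun i _ => hr i) (fun i hi => hm i hi ℓ) (fun i => (Real.exp_pos _).le)
  choose s hs using hsch
  refine ⟨s, ?_⟩
  have hlog : Tendsto (fun ℓ : ℕ => Real.log ℓ) atTop atTop :=
    Real.tendsto_log_atTop.comp tendsto_natCast_atTop_atTop
  have hdecay : ∀ c : ℝ, 0 < c → Tendsto (fun ℓ : ℕ => Real.exp (-(c * Real.log ℓ))) atTop (𝓝 0) :=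
    fun c hc => Real.tendsto_exp_neg_atTop_nhds_zero.comp (hlog.const_mul_atTop hc)
  have hlim : Tendsto (fun ℓ : ℕ => 2 ^ k * ∑ i ∈ Finset.Icc 1 k,
      (Real.exp (-(r i * (ε / 4) * Real.log ℓ)) + Real.exp (-(ε / 4 * Real.log ℓ)))) atTop
      (𝓝 0) := by
    have : Tendsto (fun ℓ : ℕ => ∑ i ∈ Finset.Icc 1 k,
      (Real.exp (-(r i * (ε / 4) * Real.log ℓ)) + Real.exp (-(ε / 4 * Real.log ℓ)))) atTop
      (𝓝 (∑ i ∈ Finset.Icc 1 k, (0 + 0))) :=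
      tendsto_finsetSum _ fun i _ => (hdecay _ (by have := hr i; positivity)).add
        (hdecay _ (by positivity))
    simpa using this.const_mul ((2 : ℝ) ^ k)
  refine squeeze_zero' (Eventually.of_forall fun ℓ => errorProb_nonneg _) ?_ hlim
  filter_upwards [eventually_ge_atTop 1] with ℓ hℓ
  refine (hs ℓ).trans ?_
  have hℓ0 : (0 : ℝ) < ℓ := by exact_mod_cast hℓ
  have hL : 0 ≤ Real.log ℓ := Real.log_nonneg (by exact_mod_cast hℓ)
  have hnℓ : (1 + ε) * (k * Real.log ℓ / I k) ≤ n ℓ := by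
    have h := Nat.le_ceil ((1 + ε) * (k * Real.logb 2 ℓ / maxRate P σ σw k))
    refine le_trans (le_of_eq ?_) h
    rw [hIk, Real.logb]
    field_simp
  refine mul_le_mul_of_nonneg_left (Finset.sum_le_sum fun i hi => ?_) (by positivity)
  have hi1 : (1 : ℝ) ≤ i := by exact_mod_cast (Finset.mem_Icc.1 hi).1
  refine add_le_add ?_ (le_of_eq ?_)
  · rw [← Real.exp_nat_mul, ← Real.exp_add, Real.exp_le_exp]
    have h1 : I k / k * (i - ε / 4) ≤ I i - η := by
      have := hchain i hi
      have h2 : i * I k / k ≤ I i := by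
        rw [div_le_iff₀ hk0]; linarith
      have h3 : I k / k * (i - ε / 4) = i * I k / k - η := by
        rw [hη]; field_simp
      rw [h3]; linarith
    have h4 : (1 + ε) * (k * Real.log ℓ / I k) * (I k / k * (i - ε / 4)) ≤ n ℓ * (I i - η) := by
      refine mul_le_mul hnℓ h1 ?_ (Nat.cast_nonneg _)
      have : 0 < i - ε / 4 := by linarith
      positivity
    have h5 : (1 + ε) * (k * Real.log ℓ / I k) * (I k / k * (i - ε / 4)) =
        (1 + ε) * (i - ε / 4) * Real.log ℓ := by field_simp
    -- Uses `1 ≤ i` and `ε < 1`. The gap from `ε / 4` in the threshold to `ε / 2` here makes the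
    -- probability of rejecting the active set decay.
    have h6 : (i + ε / 2) * Real.log ℓ ≤ (1 + ε) * (i - ε / 4) * Real.log ℓ := by
      refine mul_le_mul_of_nonneg_right ?_ hL
      nlinarith
    nlinarith [mul_le_mul_of_nonneg_left ((h6.trans_eq h5.symm).trans h4) (hr i).le]
  · rw [← Real.rpow_natCast, Real.rpow_def_of_pos hℓ0, ← Real.exp_add]
    congr 1
    ring

/-- The converse for a constant number `k` of active users. -/
lemma eventually_le_errorProb (hP : 0 < P) (hσ : 0 < σ) (hσw : 0 < σw) {k : ℕ} (hk : 1 ≤ k)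
    {ε : ℝ} (hε : 0 < ε) (hε1 : ε < 1) :
    ∀ᶠ ℓ : ℕ in atTop,
      ∀ s : Scheme ℓ k ⌊(1 - ε) * (k * Real.logb 2 ℓ / maxRate P σ σw k)⌋₊,
        ε / 2 ≤ errorProb P σ σw s := by
  have hC := (isGreatest_maxRate (k := k) hP hσ hσw hk).2
  have hl2 : 0 < Real.log 2 := Real.log_pos one_lt_two
  have hk0 : (0 : ℝ) < k := by exact_mod_cast hk
  have hlog : Tendsto (fun ℓ : ℕ => ε / 2 * k * Real.log ℓ) atTop atTop :=
    (Real.tendsto_log_atTop.comp tendsto_natCast_atTop_atTop).const_mul_atTop (by positivity)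
  -- An error below `ε / 2` would force `(ε / 2) k log ℓ ≤ log 2 + (2 - ε) k log k`, which fails for
  -- large `ℓ`.
  filter_upwards [eventually_ge_atTop (k + 1),
    hlog.eventually_gt_atTop (Real.log 2 + 2 * (k * Real.log k))] with ℓ hℓ hlarge s
  by_contra! hlt
  have hℓ1 : (1 : ℝ) ≤ ℓ := by exact_mod_cast (by omega : 1 ≤ ℓ)
  have hk1 : (1 : ℝ) ≤ k := by exact_mod_cast hk
  have hL : 0 ≤ Real.log ℓ := Real.log_nonneg hℓ1
  have hfano := one_sub_errorProb_mul_log_le (P := P) (σ := σ) hσw (by omega : k ≤ ℓ) s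
  have hM : k * Real.log ℓ - 2 * (k * Real.log k) ≤ Real.log (ℓ.choose k) :=
    sub_le_log_choose hk (by omega)
  have hnI : (⌊(1 - ε) * (k * Real.logb 2 ℓ / maxRate P σ σw k)⌋₊ : ℝ) *
      (condEntropy (s.q : ℝ) (hitProb P σ σw s.γ) k k -
        condEntropy (s.q : ℝ) (hitProb P σ σw s.γ) k 0) ≤ (1 - ε) * (k * Real.log ℓ) := by
    have hlogb : 0 ≤ Real.logb 2 ℓ := Real.logb_nonneg one_lt_two hℓ1
    have h0 : 0 ≤ (1 - ε) * (k * Real.logb 2 ℓ / maxRate P σ σw k) :=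
      mul_nonneg (by linarith) (by positivity)
    calc _ ≤ (⌊(1 - ε) * (k * Real.logb 2 ℓ / maxRate P σ σw k)⌋₊ : ℝ) *
          (maxRate P σ σw k * Real.log 2) :=
          mul_le_mul_of_nonneg_left (condEntropy_sub_le_maxRate hP hσ hσw hk s.γ_pos s.q)
            (Nat.cast_nonneg _)
      _ ≤ (1 - ε) * (k * Real.logb 2 ℓ / maxRate P σ σw k) * (maxRate P σ σw k * Real.log 2) :=
          mul_le_mul_of_nonneg_right (Nat.floor_le h0) (by positivity)
      _ = _ := by
          rw [Real.logb]
          field_simp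
  have hM0 : 0 ≤ Real.log (ℓ.choose k) := by
    refine Real.log_nonneg ?_
    exact_mod_cast Nat.choose_pos (by omega : k ≤ ℓ)
  have h1 : (1 - ε / 2) * (k * Real.log ℓ - 2 * (k * Real.log k)) ≤
      (1 - errorProb P σ σw s) * Real.log (ℓ.choose k) :=
    (mul_le_mul_of_nonneg_left hM (by linarith)).trans
      (mul_le_mul_of_nonneg_right (by linarith) hM0)
  have hlk : 0 ≤ k * Real.log k := mul_nonneg hk0.le (Real.log_nonneg hk1)
  nlinarith [mul_nonneg hε.le hlk]

end Cost

end MnAC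

/-! ### From constant to bounded numbers of active users -/

theorem theorem1 (P σ σw : ℝ≥0) (hP : 0 < P) (hσ : 0 < σ) (hσw : 0 < σw) (k : ℕ → ℕ)
    (hk : (fun ℓ => (k ℓ : ℝ)) =Θ[atTop] (fun _ => (1 : ℝ))) :
    (∀ m : ℕ, 1 ≤ m → IsGreatest (MnAC.rates P σ σw m) (MnAC.maxRate P σ σw m) ∧
      0 < MnAC.maxRate P σ σw m) ∧
    MnAC.IsMinIdentificationCost P σ σw k
      (fun ℓ => (k ℓ : ℝ) * Real.logb 2 ℓ / MnAC.maxRate P σ σw (k ℓ)) := by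
  refine ⟨fun m hm => MnAC.isGreatest_maxRate hP hσ hσw hm, fun ε hε hε1 => ?_⟩
  -- The upper half of `Θ(1)` bounds `k ℓ`. The lower half excludes `k ℓ = 0`, as it would give `1 ≤
  -- 0`.
  obtain ⟨K, hK⟩ : ∃ K : ℕ, ∀ᶠ ℓ in atTop, k ℓ ∈ Finset.Icc 1 K := by
    obtain ⟨C, hC⟩ := hk.1.bound
    obtain ⟨c, hc⟩ := hk.2.bound
    refine ⟨⌈C⌉₊, ?_⟩
    filter_upwards [hC, hc] with ℓ h1 h2
    rw [Finset.mem_Icc]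
    constructor
    · by_contra! h0
      have : k ℓ = 0 := by omega
      simp [this] at h2
      linarith
    · have h3 : (k ℓ : ℝ) ≤ C := by simpa using h1
      exact_mod_cast h3.trans (Nat.le_ceil C)
  constructor
  · have hex : ∀ m : ℕ, ∃ s : ∀ ℓ : ℕ,
        MnAC.Scheme ℓ m ⌈(1 + ε) * (m * Real.logb 2 ℓ / MnAC.maxRate P σ σw m)⌉₊,
        1 ≤ m → Tendsto (fun ℓ => MnAC.errorProb P σ σw (s ℓ)) atTop (𝓝 0) := by
      intro m
      by_cases hm : 1 ≤ m
      · obtain ⟨s, hs⟩ := MnAC.exists_schemes_tendsto hP hσ hσw hm hε hε1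
        exact ⟨s, fun _ => hs⟩
      · exact ⟨fun ℓ => (MnAC.nonempty_scheme ℓ m _).some, fun h => absurd h hm⟩
    choose s hs using hex
    -- For each `ℓ`, the scheme built for the constant value `k ℓ` is used. Only finitely many
    -- values matter, so the limits hold uniformly over them.
    refine ⟨fun ℓ => s (k ℓ) ℓ, ?_⟩
    rw [Metric.tendsto_nhds]
    intro δ hδ
    have hall : ∀ᶠ ℓ in atTop, ∀ m ∈ Finset.Icc 1 K,
        dist (MnAC.errorProb P σ σw (s m ℓ)) 0 < δ := by
      rw [Finset.eventually_all]
      exact fun m hm => Metric.tendsto_nhds.1 (hs m (Finset.mem_Icc.1 hm).1) δ hδ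
    filter_upwards [hall, hK] with ℓ h1 h2
    exact h1 _ h2
  · refine ⟨ε / 2, by positivity, ?_⟩
    have hall : ∀ᶠ ℓ in atTop, ∀ m ∈ Finset.Icc 1 K,
        ∀ s : MnAC.Scheme ℓ m ⌊(1 - ε) * (m * Real.logb 2 ℓ / MnAC.maxRate P σ σw m)⌋₊,
          ε / 2 ≤ MnAC.errorProb P σ σw s := by
      rw [Finset.eventually_all]
      exact fun m hm => MnAC.eventually_le_errorProb hP hσ hσw (Finset.mem_Icc.1 hm).1 hε hε1
    filter_upwards [hall, hK] with ℓ h1 h2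
    exact h1 _ h2
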